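/- Fix $K\ge 1$, $\gamma\in(0,1/2)$, $\alpha\in(0,1)$ and constants $0<N_0\le N_1<1$. For each $n$ let $A_n\in\{0,1\}^{n\times n}$ be a random adjacency matrix with independent entries $A_{n,ij}\sim\mathrm{Bernoulli}(M_{n,ij})$, $N_0\le M_{n,ij}\le N_1$. Let $W_{n,ij}\sim\mathrm{Bernoulli}(\gamma)$ be independent of each other and of $A_n$, and put $A^{\rm tr}_{n,ij}=A_{n,ij}(1-W_{n,ij})+(1-A_{n,ij})W_{n,ij}$ and $A^{\rm te}_n=A_n$. Let $\hat Z_n\in\{0,1\}^{n\times K}$ be a community membership matrix ($\hat Z_{n,ik}=1$ if node $i$ belongs to community $k$; no node belongs to two communities) that is a function of $A^{\rm tr}_n$ and possibly of auxiliary randomness independent of $(A_n,W_n)$. Let $u_n\in\mathbb R^{K^2}$, $\|u_n\|_2=1$, possibly depending on $A_n^{\rm tr}$ and $\hat Z_n$. For $k,\ell\in\{1,\dots,K\}$ and $s\in\{0,1\}$ put $\mathcal I_{n,k\ell}=\{(i,j):\hat Z_{n,ik}=1,\hat Z_{n,j\ell}=1\}$, $\mathcal I^{(s)}_{n,k\ell}=\{(i,j)\in\mathcal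 I_{n,k\ell}:A^{\rm tr}_{n,ij}=s\}$, $c^{(0)}=\log\frac{\gamma}{1-\gamma}$, $c^{(1)}=\log\frac{1-\gamma}{\gamma}$, and $$\hat B^{(s)}_{n,k\ell}=\frac1{|\mathcal I^{(s)}_{n,k\ell}|}\sum_{(i,j)\in\mathcal I^{(s)}_{n,k\ell}}A^{\rm te}_{n,ij},\qquad \hat V^{(s)}_{n,k\ell}=\frac{\hat B^{(s)}_{n,k\ell}}{\hat B^{(s)}_{n,k\ell}+(1-\hat B^{(s)}_{n,k\ell})e^{c^{(s)}}},\qquad \hat\Phi_{n,k\ell}=\sum_{s\in\{0,1\}}\frac{|\mathcal I^{(s)}_{n,k\ell}|}{|\mathcal I_{n,k\ell}|}\hat V^{(s)}_{n,k\ell},$$ $$\hat\Delta_{n,k\ell}=\sum_{s\in\{0,1\}}\frac{|\mathcal I^{(s)}_{n,k\ell}|^2}{|\mathcal I_{n,k\ell}|^2}\cdot\frac{\hat B^{(s)}_{n,k\ell}(1-\hat B^{(s)}_{n,k\ell})e^{2c^{(s)}}}{|\mathcal I^{(s)}_{n,k\ell}|\,\big((1-\hat B^{(s)}_{n,k\ell})e^{c^{(s)}}+\hat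 B^{(s)}_{n,k\ell}\big)^4},$$ $\hat\xi_n=u_n^\top\mathrm{vec}(\hat\Phi_n)$ and $\hat\sigma_n^2=u_n^\top\mathrm{diag}(\mathrm{vec}(\hat\Delta_n))u_n$. Let $\phi_{1-\alpha/2}$ be the $(1-\alpha/2)$-quantile of $\mathcal N(0,1)$ and define the target $$\theta_n(A_n^{\rm tr})=u_n^\top\mathrm{vec}\Big((\hat Z_n^\top\hat Z_n)^{-1}\hat Z_n^\top\,\mathbb E[A_n]\,\hat Z_n(\hat Z_n^\top\hat Z_n)^{-1}\Big).$$ Let $(a_n)$ and $(z_n)$ be sequences of realizations of $A_n^{\rm tr}$ and $\hat Z_n$ (the event $\{A_n^{\rm tr}=a_n,\hat Z_n=z_n\}$ has positive probability) such that, along them, (i) for all $k,\ell$ and $s\in\{0,1\}$, $\mathcal I^{(s)}_{n,k\ell}$ is nonempty for all large $n$ and $|\mathcal I^{(s)}_{n,k\ell}|^{-1}=O(n^{-2})$; (ii) there is an $N$ such that for all $n\ge N$ and all $(k,\ell)$ for which the corresponding entry of $u_n$ is nonzero, $M_{n,ij}$ takes a single value on $(i,j)\in\mathcal I_{n,k\ell}$.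 Then $$\lim_{n\to\infty}P\Big(\theta_n(A_n^{\rm tr})\in\big[\hat\xi_n-\phi_{1-\alpha/2}\hat\sigma_n,\ \hat\xi_n+\phi_{1-\alpha/2}\hat\sigma_n\big]\ \Big|\ A_n^{\rm tr}=a_n,\ \hat Z_n=z_n\Big)=1-\alpha .$$ -/

import Mathlib

open MeasureTheory ProbabilityTheory Filter Topology Asymptotics

namespace NetworkFission

noncomputable section

/-- `X` is a `{0,1}`-valued random variable with success probability `p ∈ [0,1]`. -/
def IsBernoulli {Ω : Type*} [MeasurableSpace Ω] (X : Ω → ℝ) (p : ℝ) (P : Measure Ω) : Prop :=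
  ∃ hp : p ∈ Set.Icc (0 : ℝ) 1, HasLaw X (bernoulliMeasure (1 : ℝ) 0 ⟨p, hp⟩) P

/-- The random adjacency matrix `A` and the random matrix of toggles `W`, listed entry by entry as
one family of real random variables. -/
def entries {Ω : Type*} {n : ℕ} (A W : Ω → Matrix (Fin n) (Fin n) ℝ) :
    (Fin n × Fin n) ⊕ (Fin n × Fin n) → Ω → ℝ :=
  Sum.elim (fun p ω => A ω p.1 p.2) (fun p ω => W ω p.1 p.2)

/-- The sampling model: the entries of `A` are Bernoulli with means `M i j`, the toggles `W i j` are
Bernoulli with mean `γ`, and all of them are mutually independent. -/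
structure IsBernoulliModel {Ω : Type*} [MeasurableSpace Ω] {n : ℕ} (P : Measure Ω)
    (M : Matrix (Fin n) (Fin n) ℝ) (γ : ℝ) (A W : Ω → Matrix (Fin n) (Fin n) ℝ) : Prop where
  measurable : ∀ x, Measurable (entries A W x)
  edge_law : ∀ i j, IsBernoulli (fun ω => A ω i j) (M i j) P
  toggle_law : ∀ i j, IsBernoulli (fun ω => W ω i j) γ P
  indep : iIndepFun (entries A W) P

/-- The train network `A (1 - W) + (1 - A) W` (entrywise).  The test network is `A` itself. -/
def train {n : ℕ} (A W : Matrix (Fin n) (Fin n) ℝ) : Matrix (Fin n) (Fin n) ℝ :=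
  Matrix.of fun i j => A i j * (1 - W i j) + (1 - A i j) * W i j

/-- The entrywise expectation `E[A]`. -/
def expectation {Ω : Type*} [MeasurableSpace Ω] {n : ℕ} (P : Measure Ω)
    (A : Ω → Matrix (Fin n) (Fin n) ℝ) : Matrix (Fin n) (Fin n) ℝ :=
  Matrix.of fun i j => ∫ ω, A ω i j ∂P

/-- `Z` is a `{0,1}`-valued community membership matrix: no node lies in two communities. -/
structure IsMembership {n K : ℕ} (Z : Matrix (Fin n) (Fin K) ℝ) : Prop where
  zero_or_one : ∀ i k, Z i k = 0 ∨ Z i k = 1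
  unique : ∀ i k l, Z i k = 1 → Z i l = 1 → k = l

section Estimators

variable {n K : ℕ}

open Classical in
/-- The set of dyads from community `k` to community `l`. -/
def block (Z : Matrix (Fin n) (Fin K) ℝ) (k l : Fin K) : Finset (Fin n × Fin n) :=
  Finset.univ.filter fun p => Z p.1 k = 1 ∧ Z p.2 l = 1

open Classical in
/-- The dyads of `block Z k l` on which the train network `a` has the value `s ∈ {0,1}`. -/
def subBlock (Z : Matrix (Fin n) (Fin K) ℝ) (a : Matrix (Fin n) (Fin n) ℝ) (s : Fin 2)
    (k l : Fin K) : Finset (Fin n × Fin n) :=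
  (block Z k l).filter fun p => a p.1 p.2 = ((s : ℕ) : ℝ)

/-- `c⁽⁰⁾ = log (γ / (1 - γ))` and `c⁽¹⁾ = log ((1 - γ) / γ)`. -/
def shift (γ : ℝ) (s : Fin 2) : ℝ :=
  if s = 0 then Real.log (γ / (1 - γ)) else Real.log ((1 - γ) / γ)

/-- The average of the test network over a sub-block. -/
def Bhat (Z : Matrix (Fin n) (Fin K) ℝ) (a te : Matrix (Fin n) (Fin n) ℝ) (s : Fin 2)
    (k l : Fin K) : ℝ :=
  (∑ p ∈ subBlock Z a s k l, te p.1 p.2) / ((subBlock Z a s k l).card : ℝ)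

def Vhat (γ : ℝ) (Z : Matrix (Fin n) (Fin K) ℝ) (a te : Matrix (Fin n) (Fin n) ℝ) (s : Fin 2)
    (k l : Fin K) : ℝ :=
  Bhat Z a te s k l /
    (Bhat Z a te s k l + (1 - Bhat Z a te s k l) * Real.exp (shift γ s))

/-- The proportion of the dyads of a block that lie in its sub-block with train value `s`. -/
def blockFraction (Z : Matrix (Fin n) (Fin K) ℝ) (a : Matrix (Fin n) (Fin n) ℝ) (s : Fin 2)
    (k l : Fin K) : ℝ :=
  ((subBlock Z a s k l).card : ℝ) / ((block Z k l).card : ℝ)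

def PhiHat (γ : ℝ) (Z : Matrix (Fin n) (Fin K) ℝ) (a te : Matrix (Fin n) (Fin n) ℝ) :
    Matrix (Fin K) (Fin K) ℝ :=
  Matrix.of fun k l => ∑ s : Fin 2, blockFraction Z a s k l * Vhat γ Z a te s k l

def subDeltaHat (γ : ℝ) (Z : Matrix (Fin n) (Fin K) ℝ) (a te : Matrix (Fin n) (Fin n) ℝ)
    (s : Fin 2) (k l : Fin K) : ℝ :=
  Bhat Z a te s k l * (1 - Bhat Z a te s k l) * Real.exp (2 * shift γ s) /
    (((subBlock Z a s k l).card : ℝ) *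
      ((1 - Bhat Z a te s k l) * Real.exp (shift γ s) + Bhat Z a te s k l) ^ 4)

def DeltaHat (γ : ℝ) (Z : Matrix (Fin n) (Fin K) ℝ) (a te : Matrix (Fin n) (Fin n) ℝ) :
    Matrix (Fin K) (Fin K) ℝ :=
  Matrix.of fun k l => ∑ s : Fin 2, blockFraction Z a s k l ^ 2 * subDeltaHat γ Z a te s k l

/-- The estimator `uᵀ vec(Φ̂)`.  Here `vec` stacks columns, so that the entry of `u` that multiplies
the matrix entry `(k, l)` is `u (l, k)`. -/
def xiHat (γ : ℝ) (Z : Matrix (Fin n) (Fin K) ℝ) (a te : Matrix (Fin n) (Fin n) ℝ)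
    (u : EuclideanSpace ℝ (Fin K × Fin K)) : ℝ :=
  u.ofLp ⬝ᵥ (PhiHat γ Z a te).vec

/-- The estimated standard error, the square root of `uᵀ diag(vec(Δ̂)) u`. -/
def sigmaHat (γ : ℝ) (Z : Matrix (Fin n) (Fin K) ℝ) (a te : Matrix (Fin n) (Fin n) ℝ)
    (u : EuclideanSpace ℝ (Fin K × Fin K)) : ℝ :=
  Real.sqrt (u.ofLp ⬝ᵥ (Matrix.diagonal (DeltaHat γ Z a te).vec).mulVec u.ofLp)

/-- The `p`-quantile of the standard normal distribution. -/
def normalQuantile (p : ℝ) : ℝ :=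
  sInf {x : ℝ | p ≤ cdf (gaussianReal 0 1) x}

/-- The interval `ξ̂ ± φ_{1-α/2} σ̂`. -/
def interval (γ α : ℝ) (Z : Matrix (Fin n) (Fin K) ℝ) (a te : Matrix (Fin n) (Fin n) ℝ)
    (u : EuclideanSpace ℝ (Fin K × Fin K)) : Set ℝ :=
  Set.Icc (xiHat γ Z a te u - normalQuantile (1 - α / 2) * sigmaHat γ Z a te u)
    (xiHat γ Z a te u + normalQuantile (1 - α / 2) * sigmaHat γ Z a te u)

/-- The target `uᵀ vec((ZᵀZ)⁻¹ Zᵀ E[A] Z (ZᵀZ)⁻¹)`, for a mean matrix `EA`. -/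
def target (EA : Matrix (Fin n) (Fin n) ℝ) (Z : Matrix (Fin n) (Fin K) ℝ)
    (u : EuclideanSpace ℝ (Fin K × Fin K)) : ℝ :=
  u.ofLp ⬝ᵥ
    ((Z.transpose * Z)⁻¹ * Z.transpose * EA * Z * (Z.transpose * Z)⁻¹).vec

end Estimators

end

end NetworkFission

namespace NetworkFission

/-! Conditioning. On the event that the train network equals `a`, detection is applied to `a`, so
the conditioning event splits into an event of the auxiliary randomness, which leaves the model
unchanged, and the event that every dyad has its prescribed train value. The dyads are independent,
so the edges remain independent, and Bayes' rule multiplies the odds of an edge of mean `m` by `exp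
(shift γ s)` when its train value is `s`. The map `debias` divides the odds by the same factor,
hence `debias_condMean`. Since the two train fractions of a block sum to one, the estimation error
is a weighted sum, over cells (sub-blocks), of debiased cell averages minus debiased expectations
(`xiHat_sub_target`), and `sigmaHat` is the delta-method standard deviation evaluated at the cell
averages (`sigmaHat_eq`).

Delta method. Cells have size of order `n ^ 2` and conditional means bounded away from 0 and 1, so
the linear part of the error has standard deviation of exact order `1 / n`, while each normalised
summand is `O(1 / n)`; a triangular-array central limit theorem, proved with characteristic
functions, applies. By Chebyshev, all relevant cell averages lie within `ε / √n` of their means with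
probability tending to one. There the quadratic remainder is at most a constant times `ε ^ 2 / n`, a
small multiple of the standard deviation when `ε` is small, and the estimated standard deviation is
close to the true one in ratio. A sandwich between the events `|S| ≤ φ ± δ`, with `S` the normalised
linear part, and continuity of the Gaussian limit in `φ` finish the proof
(`tendsto_measureReal_coverage`). -/

/-! ### Central limit theorem by characteristic functions -/

lemma norm_prod_sub_prod_le {ι : Type*} (s : Finset ι) (f g : ι → ℂ)
    (hf : ∀ i ∈ s, ‖f i‖ ≤ 1) (hg : ∀ i ∈ s, ‖g i‖ ≤ 1) :
    ‖∏ i ∈ s, f i - ∏ i ∈ s, g i‖ ≤ ∑ i ∈ s, ‖f i - g i‖ := by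
  classical
  induction s using Finset.induction_on with
  | empty => simp
  | insert i s hi ih =>
    rw [Finset.prod_insert hi, Finset.prod_insert hi, Finset.sum_insert hi]
    have h1 : ‖∏ j ∈ s, f j‖ ≤ 1 := by
      rw [norm_prod]
      exact Finset.prod_le_one (fun _ _ => norm_nonneg _)
        fun j hj => hf j (Finset.mem_insert_of_mem hj)
    have h2 := ih (fun j hj => hf j (Finset.mem_insert_of_mem hj))
      (fun j hj => hg j (Finset.mem_insert_of_mem hj))
    have h3 := hg i (Finset.mem_insert_self i s)
    -- Telescoping: exchange one factor at a time, all other factors having norm at most one.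
    calc ‖f i * ∏ j ∈ s, f j - g i * ∏ j ∈ s, g j‖
        = ‖(f i - g i) * ∏ j ∈ s, f j + g i * (∏ j ∈ s, f j - ∏ j ∈ s, g j)‖ := by
          congr 1; ring
      _ ≤ ‖f i - g i‖ * ‖∏ j ∈ s, f j‖ + ‖g i‖ * ‖∏ j ∈ s, f j - ∏ j ∈ s, g j‖ :=
          (norm_add_le _ _).trans (by rw [norm_mul, norm_mul])
      _ ≤ ‖f i - g i‖ * 1 + 1 * ∑ j ∈ s, ‖f j - g j‖ := by gcongr
      _ = _ := by ring

lemma norm_exp_mul_I_sub_le {x : ℝ} (hx : |x| ≤ 1) :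
    ‖Complex.exp (x * Complex.I) - (1 + x * Complex.I - x ^ 2 / 2)‖ ≤ |x| ^ 3 := by
  have hn : ‖(x : ℂ) * Complex.I‖ = |x| := by simp
  have h := Complex.exp_bound (x := (x : ℂ) * Complex.I) (by rw [hn]; exact hx)
    (n := 3) (by norm_num)
  rw [hn] at h
  have e : ∑ m ∈ Finset.range 3, ((x : ℂ) * Complex.I) ^ m / (m.factorial : ℂ)
      = 1 + x * Complex.I - x ^ 2 / 2 := by
    simp [Finset.sum_range_succ, mul_pow]
    ring
  rw [e] at h
  refine h.trans ?_
  have : 0 ≤ |x| ^ 3 := by positivity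
  norm_num [Nat.factorial]
  linarith

section CentralLimit

variable {Ω : Type*} [MeasurableSpace Ω] {Q : Measure Ω} [IsProbabilityMeasure Q]

/-- Second order expansion of the characteristic function of a bounded centred variable. -/
lemma norm_charFun_sub_exp_le {Y : Ω → ℝ} (hY : Measurable Y) (h0 : ∫ ω, Y ω ∂Q = 0) {b t : ℝ}
    (hb : ∀ᵐ ω ∂Q, |Y ω| ≤ b) (htb : |t| * b ≤ 1) :
    ‖charFun (Q.map Y) t - Complex.exp (-(t ^ 2 * ∫ ω, Y ω ^ 2 ∂Q) / 2 : ℝ)‖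
      ≤ (|t| ^ 3 * b + t ^ 4 * b ^ 2) * ∫ ω, Y ω ^ 2 ∂Q := by
  set v := ∫ ω, Y ω ^ 2 ∂Q with hv
  have hb0 : 0 ≤ b := by
    obtain ⟨ω, hω⟩ := hb.exists
    exact (abs_nonneg _).trans hω
  have iY : Integrable Y Q := Integrable.of_bound hY.aestronglyMeasurable b (by simpa using hb)
  have hsq : ∀ᵐ ω ∂Q, Y ω ^ 2 ≤ b ^ 2 := by
    filter_upwards [hb] with ω hω
    exact sq_le_sq' (by linarith [neg_abs_le (Y ω)]) (by linarith [le_abs_self (Y ω)])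
  have iY2 : Integrable (fun ω => Y ω ^ 2) Q :=
    Integrable.of_bound (hY.pow_const 2).aestronglyMeasurable (b ^ 2) (by
      filter_upwards [hsq] with ω hω
      rw [Real.norm_of_nonneg (sq_nonneg _)]; exact hω)
  have hv0 : 0 ≤ v := integral_nonneg fun _ => sq_nonneg _
  have hvb : v ≤ b ^ 2 := by
    calc v ≤ ∫ _, b ^ 2 ∂Q := integral_mono_ae iY2 (integrable_const _) hsq
      _ = b ^ 2 := by simp
  have hc : charFun (Q.map Y) t = ∫ ω, Complex.exp (((t * Y ω : ℝ) : ℂ) * Complex.I) ∂Q := by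
    rw [charFun_apply_real, integral_map hY.aemeasurable (by fun_prop)]
    push_cast; rfl
  have iE : Integrable (fun ω => Complex.exp (((t * Y ω : ℝ) : ℂ) * Complex.I)) Q :=
    Integrable.of_bound (by fun_prop) 1 (by
      filter_upwards with ω
      rw [Complex.norm_exp_ofReal_mul_I])
  have iT : Integrable (fun ω => 1 + ((t * Y ω : ℝ) : ℂ) * Complex.I
      - ((t * Y ω : ℝ) : ℂ) ^ 2 / 2) Q := by
    have e : (fun ω => 1 + ((t * Y ω : ℝ) : ℂ) * Complex.I - ((t * Y ω : ℝ) : ℂ) ^ 2 / 2)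
        = fun ω => 1 + (t * Complex.I) * (Y ω : ℂ) - (t ^ 2 / 2) * ((Y ω ^ 2 : ℝ) : ℂ) := by
      funext ω; push_cast; ring
    rw [e]
    exact ((integrable_const _).add (iY.ofReal.const_mul _)).sub (iY2.ofReal.const_mul _)
  have hT : ∫ ω, (1 + ((t * Y ω : ℝ) : ℂ) * Complex.I - ((t * Y ω : ℝ) : ℂ) ^ 2 / 2) ∂Q
      = ((1 - t ^ 2 * v / 2 : ℝ) : ℂ) := by
    have e : (fun ω => 1 + ((t * Y ω : ℝ) : ℂ) * Complex.I - ((t * Y ω : ℝ) : ℂ) ^ 2 / 2)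
        = fun ω => (1 + (t * Complex.I) * (Y ω : ℂ)) - (t ^ 2 / 2) * ((Y ω ^ 2 : ℝ) : ℂ) := by
      funext ω; push_cast; ring
    rw [e, integral_sub ((integrable_const _).add (iY.ofReal.const_mul _))
      (iY2.ofReal.const_mul _), integral_add (integrable_const _) (iY.ofReal.const_mul _),
      integral_const_mul, integral_const_mul, integral_complex_ofReal, integral_complex_ofReal,
      h0, ← hv]
    simp
    ring
  have h1 : ‖charFun (Q.map Y) t - ((1 - t ^ 2 * v / 2 : ℝ) : ℂ)‖ ≤ |t| ^ 3 * b * v := by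
    rw [hc, ← hT, ← integral_sub iE iT]
    calc _ ≤ ∫ ω, |t| ^ 3 * b * Y ω ^ 2 ∂Q := by
          refine norm_integral_le_of_norm_le (iY2.const_mul _) ?_
          filter_upwards [hb] with ω hω
          have h2 : |t * Y ω| ≤ 1 := by
            rw [abs_mul]
            exact (mul_le_mul_of_nonneg_left hω (abs_nonneg t)).trans htb
          refine (norm_exp_mul_I_sub_le h2).trans ?_
          rw [abs_mul, mul_pow, mul_assoc]
          refine mul_le_mul_of_nonneg_left ?_ (by positivity)
          calc |Y ω| ^ 3 = |Y ω| * Y ω ^ 2 := by rw [← sq_abs (Y ω)]; ring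
            _ ≤ b * Y ω ^ 2 := mul_le_mul_of_nonneg_right hω (sq_nonneg _)
      _ = |t| ^ 3 * b * v := by rw [integral_const_mul]
  have h2 : ‖((1 - t ^ 2 * v / 2 : ℝ) : ℂ) - Complex.exp (-(t ^ 2 * v) / 2 : ℝ)‖
      ≤ t ^ 4 * b ^ 2 * v := by
    rw [← Complex.ofReal_exp, ← Complex.ofReal_sub, Complex.norm_real, norm_sub_rev]
    have htb2 : t ^ 2 * b ^ 2 ≤ 1 := by
      rw [← sq_abs t, ← mul_pow]
      exact pow_le_one₀ (by positivity) htb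
    have hle : t ^ 2 * v ≤ 1 := (mul_le_mul_of_nonneg_left hvb (sq_nonneg t)).trans htb2
    have h0' : 0 ≤ t ^ 2 * v := by positivity
    have h3 := Real.abs_exp_sub_one_sub_id_le (x := -(t ^ 2 * v) / 2) (by
      rw [abs_le]; constructor <;> linarith)
    have e : Real.exp (-(t ^ 2 * v) / 2) - (1 - t ^ 2 * v / 2)
        = Real.exp (-(t ^ 2 * v) / 2) - 1 - (-(t ^ 2 * v) / 2) := by ring
    rw [e, Real.norm_eq_abs]
    refine h3.trans ?_
    have h4 : t ^ 4 * v * v ≤ t ^ 4 * v * b ^ 2 := mul_le_mul_of_nonneg_left hvb (by positivity)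
    have h5 : 0 ≤ t ^ 4 * v * v := by positivity
    calc (-(t ^ 2 * v) / 2) ^ 2 = t ^ 4 * v * v / 4 := by ring
      _ ≤ t ^ 4 * v * b ^ 2 := by linarith
      _ = _ := by ring
  calc _ ≤ |t| ^ 3 * b * v + t ^ 4 * b ^ 2 * v := (norm_sub_le_norm_sub_add_norm_sub _ _ _).trans
        (add_le_add h1 h2)
    _ = _ := by ring

/-- The Gaussian factor splits into factors with the variances of the summands. Each factor is
replaced at a cost proportional to its variance, and the variances sum to one. -/
lemma norm_charFun_sum_sub_exp_le {ι : Type*} [Fintype ι] {Y : ι → Ω → ℝ}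
    (hY : ∀ i, Measurable (Y i)) (hind : iIndepFun Y Q) (h0 : ∀ i, ∫ ω, Y i ω ∂Q = 0) {b t : ℝ}
    (hb : ∀ i, ∀ᵐ ω ∂Q, |Y i ω| ≤ b) (hvar : ∑ i, ∫ ω, Y i ω ^ 2 ∂Q = 1) (htb : |t| * b ≤ 1) :
    ‖charFun (Q.map fun ω => ∑ i, Y i ω) t - Complex.exp (-(t ^ 2) / 2 : ℝ)‖
      ≤ |t| ^ 3 * b + t ^ 4 * b ^ 2 := by
  rw [hind.charFun_map_fun_sum_eq_prod (fun i => (hY i).aemeasurable)]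
  have e : Complex.exp (-(t ^ 2) / 2 : ℝ)
      = ∏ i, Complex.exp (-(t ^ 2 * ∫ ω, Y i ω ^ 2 ∂Q) / 2 : ℝ) := by
    rw [← Complex.exp_sum, ← Complex.ofReal_sum, ← Finset.sum_div, Finset.sum_neg_distrib,
      ← Finset.mul_sum, hvar, mul_one]
  rw [e, Finset.prod_apply]
  have : ∀ i, IsProbabilityMeasure (Q.map (Y i)) := fun i =>
    Measure.isProbabilityMeasure_map (hY i).aemeasurable
  refine (norm_prod_sub_prod_le _ _ _ (fun i _ => norm_charFun_le_one t) fun i _ => ?_).trans ?_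
  · rw [← Complex.ofReal_exp, Complex.norm_real, Real.norm_of_nonneg (Real.exp_pos _).le,
      Real.exp_le_one_iff]
    have : 0 ≤ t ^ 2 * ∫ ω, Y i ω ^ 2 ∂Q :=
      mul_nonneg (sq_nonneg t) (integral_nonneg fun _ => sq_nonneg _)
    linarith
  · calc _ ≤ ∑ i, (|t| ^ 3 * b + t ^ 4 * b ^ 2) * ∫ ω, Y i ω ^ 2 ∂Q :=
          Finset.sum_le_sum fun i _ => norm_charFun_sub_exp_le (hY i) (h0 i) (hb i) htb
      _ = _ := by rw [← Finset.mul_sum, hvar, mul_one]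

end CentralLimit

instance : NullSingletonClass (gaussianReal 0 1) := nullSingletonClass_gaussianReal one_ne_zero

/-- Central limit theorem for triangular arrays of uniformly small bounded variables. -/
theorem tendsto_measureReal_abs_sum_le {Ω : ℕ → Type*} [∀ n, MeasurableSpace (Ω n)]
    (Q : ∀ n, Measure (Ω n)) [∀ n, IsProbabilityMeasure (Q n)] {ι : ℕ → Type*} [∀ n, Fintype (ι n)]
    (Y : ∀ n, ι n → Ω n → ℝ) (hY : ∀ n i, Measurable (Y n i)) (hind : ∀ n, iIndepFun (Y n) (Q n))
    (h0 : ∀ n i, ∫ ω, Y n i ω ∂Q n = 0) (b : ℕ → ℝ) (hb : Tendsto b atTop (𝓝 0))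
    (hYb : ∀ᶠ n in atTop, ∀ i, ∀ᵐ ω ∂Q n, |Y n i ω| ≤ b n)
    (hvar : ∀ᶠ n in atTop, ∑ i, ∫ ω, Y n i ω ^ 2 ∂Q n = 1) (c : ℝ) :
    Tendsto (fun n => (Q n).real {ω | |∑ i, Y n i ω| ≤ c}) atTop
      (𝓝 ((gaussianReal 0 1).real (Set.Icc (-c) c))) := by
  have hm : ∀ n, Measurable fun ω => ∑ i, Y n i ω := fun n =>
    Finset.measurable_sum _ fun i _ => hY n i
  let ν : ℕ → ProbabilityMeasure ℝ := fun n =>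
    ⟨(Q n).map fun ω => ∑ i, Y n i ω, Measure.isProbabilityMeasure_map (hm n).aemeasurable⟩
  let g : ProbabilityMeasure ℝ := ⟨gaussianReal 0 1, inferInstance⟩
  have hν : Tendsto ν atTop (𝓝 g) := by
    refine ProbabilityMeasure.tendsto_iff_tendsto_charFun.2 fun t => ?_
    have hg : charFun (g : Measure ℝ) t = Complex.exp (-(t ^ 2) / 2 : ℝ) := by
      change charFun (gaussianReal 0 1) t = _
      rw [charFun_gaussianReal]
      push_cast
      congr 1
      ring
    rw [hg, tendsto_iff_norm_sub_tendsto_zero]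
    have hlim : Tendsto (fun n => |t| ^ 3 * b n + t ^ 4 * b n ^ 2) atTop (𝓝 0) := by
      have := (hb.const_mul (|t| ^ 3)).add ((hb.pow 2).const_mul (t ^ 4))
      simpa using this
    have htb : ∀ᶠ n in atTop, |t| * b n ≤ 1 := by
      have := hb.const_mul |t|
      rw [mul_zero] at this
      exact (this.eventually (gt_mem_nhds one_pos)).mono fun n hn => hn.le
    refine squeeze_zero' (Eventually.of_forall fun _ => norm_nonneg _) ?_ hlim
    filter_upwards [hYb, hvar, htb] with n h1 h2 h3
    exact norm_charFun_sum_sub_exp_le (hY n) (hind n) (h0 n) h1 h2 h3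
  have hfr : (g : Measure ℝ) (frontier (Set.Icc (-c) c)) = 0 := by
    have : (frontier (Set.Icc (-c) c)) ⊆ {-c, c} := by
      rcases le_total (-c) c with h | h
      · rw [frontier_Icc h]
      · rcases h.eq_or_lt with h | h
        · rw [← h]; simp [frontier]
        · rw [Set.Icc_eq_empty (not_le.2 h)]; simp
    exact measure_mono_null this (Set.Finite.measure_zero (Set.toFinite _) (gaussianReal 0 1))
  have h := ProbabilityMeasure.tendsto_measure_of_null_frontier_of_tendsto' hν hfr
  have h' := (ENNReal.tendsto_toReal (measure_ne_top _ _)).comp h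
  refine h'.congr fun n => ?_
  change ((Q n).map (fun ω => ∑ i, Y n i ω) (Set.Icc (-c) c)).toReal = _
  rw [Measure.map_apply (hm n) measurableSet_Icc, measureReal_def]
  congr 2
  ext ω
  simp [abs_le]

/-! ### The standard normal distribution function and its quantiles -/

lemma continuous_cdf_gaussianReal : Continuous (cdf (gaussianReal 0 1)) := by
  refine continuous_iff_continuousAt.2 fun x => ?_
  rw [(monotone_cdf _).continuousAt_iff_leftLim_eq_rightLim, StieltjesFunction.rightLim_eq]
  have h : (cdf (gaussianReal 0 1)).measure {x} = 0 := by
    rw [measure_cdf]; exact measure_singleton x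
  rw [StieltjesFunction.measure_singleton, ENNReal.ofReal_eq_zero] at h
  exact le_antisymm ((monotone_cdf _).leftLim_le le_rfl) (by linarith)

/-- The truncation at 0 covers negative `c`, which occur because the sandwich argument evaluates the
limit at `φ - δ`; the formula gives continuity on the whole line. -/
lemma gaussianReal_Icc_eq (c : ℝ) : (gaussianReal 0 1).real (Set.Icc (-c) c) =
    max (cdf (gaussianReal 0 1) c - cdf (gaussianReal 0 1) (-c)) 0 := by
  rcases le_or_gt 0 c with hc | hc
  · rw [max_eq_left (sub_nonneg.2 (monotone_cdf _ (by linarith))), cdf_eq_real, cdf_eq_real,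
      ← measureReal_congr Ioc_ae_eq_Icc, ← Set.Iic_sdiff_Iic,
      measureReal_sdiff (Set.Iic_subset_Iic.2 (by linarith)) measurableSet_Iic]
  · rw [Set.Icc_eq_empty (by linarith), measureReal_empty,
      max_eq_right (sub_nonpos.2 (monotone_cdf _ (by linarith)))]

lemma continuous_gaussianReal_Icc :
    Continuous fun c : ℝ => (gaussianReal 0 1).real (Set.Icc (-c) c) := by
  simp_rw [gaussianReal_Icc_eq]
  have := continuous_cdf_gaussianReal
  fun_prop

lemma cdf_gaussianReal_neg (x : ℝ) :
    cdf (gaussianReal 0 1) (-x) = 1 - cdf (gaussianReal 0 1) x := by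
  have h : (gaussianReal 0 1).real (Set.Iic (-x)) = (gaussianReal 0 1).real (Set.Ici x) := by
    conv_lhs => rw [← neg_zero (G := ℝ), ← gaussianReal_map_neg]
    rw [measureReal_def, Measure.map_apply measurable_neg measurableSet_Iic, measureReal_def]
    congr 2
    ext y
    simp
  rw [cdf_eq_real, cdf_eq_real, h, ← probReal_compl_eq_one_sub measurableSet_Iic, Set.compl_Iic,
    measureReal_congr Ioi_ae_eq_Ici]

lemma cdf_normalQuantile {p : ℝ} (hp : p ∈ Set.Ioo (0 : ℝ) 1) :
    cdf (gaussianReal 0 1) (normalQuantile p) = p := by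
  set F := cdf (gaussianReal 0 1) with hF
  obtain ⟨y, hy⟩ := ((tendsto_cdf_atBot (gaussianReal 0 1)).eventually (gt_mem_nhds hp.1)).exists
  obtain ⟨w, hw⟩ := ((tendsto_cdf_atTop (gaussianReal 0 1)).eventually (lt_mem_nhds hp.2)).exists
  obtain ⟨x, hx⟩ : ∃ x, F x = p :=
    mem_range_of_exists_le_of_exists_ge continuous_cdf_gaussianReal ⟨y, hy.le⟩ ⟨w, hw.le⟩
  have hbdd : BddBelow {x : ℝ | p ≤ F x} :=
    ⟨y, fun v hv => le_of_not_gt fun h => (hy.trans_le hv).not_ge (monotone_cdf _ h.le)⟩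
  have hcl : IsClosed {x : ℝ | p ≤ F x} := isClosed_le continuous_const continuous_cdf_gaussianReal
  -- The infimum belongs to the closed superlevel set, which gives one inequality; it is at most
  -- `x`, where the value `p` is attained, which gives the other.
  refine le_antisymm ?_ (hcl.csInf_mem ⟨x, hx.ge⟩ hbdd)
  conv_rhs => rw [← hx]
  exact monotone_cdf _ (csInf_le hbdd hx.ge)

lemma normalQuantile_nonneg {p : ℝ} (hp : p ∈ Set.Ioo (0 : ℝ) 1) (hp' : 1 / 2 ≤ p) :
    0 ≤ normalQuantile p := by
  by_contra! h
  have h0 : cdf (gaussianReal 0 1) 0 = 1 / 2 := by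
    have := cdf_gaussianReal_neg 0
    rw [neg_zero] at this
    linarith
  have h1 := monotone_cdf (gaussianReal 0 1) h.le
  -- A negative quantile would leave no Gaussian mass between it and 0, although Lebesgue measure is
  -- absolutely continuous with respect to the Gaussian.
  have h2 : (gaussianReal 0 1).real (Set.Ioc (normalQuantile p) 0) = 0 := by
    rw [← Set.Iic_sdiff_Iic, measureReal_sdiff (Set.Iic_subset_Iic.2 h.le) measurableSet_Iic,
      ← cdf_eq_real, ← cdf_eq_real, cdf_normalQuantile hp]
    rw [cdf_normalQuantile hp] at h1
    linarith
  rw [measureReal_eq_zero_iff] at h2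
  have h3 := gaussianReal_absolutelyContinuous' 0 one_ne_zero h2
  rw [Real.volume_Ioc, ENNReal.ofReal_eq_zero] at h3
  linarith

lemma gaussianReal_Icc_normalQuantile {α : ℝ} (hα : α ∈ Set.Ioo (0 : ℝ) 1) :
    (gaussianReal 0 1).real (Set.Icc (-normalQuantile (1 - α / 2)) (normalQuantile (1 - α / 2)))
      = 1 - α := by
  have hp : 1 - α / 2 ∈ Set.Ioo (0 : ℝ) 1 := ⟨by linarith [hα.2], by linarith [hα.1]⟩
  rw [gaussianReal_Icc_eq, cdf_gaussianReal_neg, cdf_normalQuantile hp, max_eq_left] <;>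
    linarith [hα.2]

/-! ### Stability of limiting probabilities under small perturbations -/

/-- If the events `C n` agree with `|S n| ≤ φ` up to small changes of `φ` and up to events of small
probability, then they have the same limiting probability. -/
lemma tendsto_measureReal_of_sandwich {Ω : ℕ → Type*} [∀ n, MeasurableSpace (Ω n)]
    (Q : ∀ n, Measure (Ω n)) [∀ n, IsProbabilityMeasure (Q n)] (S : ∀ n, Ω n → ℝ)
    {H : ℝ → ℝ} (hH : Continuous H)
    (hS : ∀ c, Tendsto (fun n => (Q n).real {ω | |S n ω| ≤ c}) atTop (𝓝 (H c)))
    (C : ∀ n, Set (Ω n)) {φ : ℝ}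
    (hC : ∀ δ > 0, ∃ G : ∀ n, Set (Ω n), Tendsto (fun n => (Q n).real (G n)ᶜ) atTop (𝓝 0) ∧
      ∀ᶠ n in atTop, ∀ ω ∈ G n, (ω ∈ C n → |S n ω| ≤ φ + δ) ∧ (|S n ω| ≤ φ - δ → ω ∈ C n)) :
    Tendsto (fun n => (Q n).real (C n)) atTop (𝓝 (H φ)) := by
  rw [Metric.tendsto_atTop']
  intro ε hε
  obtain ⟨δ, hδ, hδH⟩ := Metric.continuous_iff.1 hH φ (ε / 2) (by positivity)
  obtain ⟨G, hG, hsand⟩ := hC (δ / 2) (by positivity)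
  have hu := hδH (φ + δ / 2) (by rw [Real.dist_eq, abs_lt]; constructor <;> linarith)
  have hl := hδH (φ - δ / 2) (by rw [Real.dist_eq, abs_lt]; constructor <;> linarith)
  rw [Real.dist_eq, abs_lt] at hu hl
  have e1 := (hS (φ + δ / 2)).add hG
  have e2 := (hS (φ - δ / 2)).sub hG
  rw [add_zero] at e1
  rw [sub_zero] at e2
  have e1' := e1.eventually (gt_mem_nhds (show H (φ + δ / 2) < H φ + ε by linarith))
  have e2' := e2.eventually (lt_mem_nhds (show H φ - ε < H (φ - δ / 2) by linarith))
  obtain ⟨N, hN⟩ := eventually_atTop.1 ((hsand.and e1').and e2')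
  refine ⟨N, fun n hn => ?_⟩
  obtain ⟨⟨h1, h2⟩, h3⟩ := hN n hn.le
  have u1 : (Q n).real (C n) ≤ (Q n).real {ω | |S n ω| ≤ φ + δ / 2} + (Q n).real (G n)ᶜ := by
    refine (measureReal_mono ?_).trans (measureReal_union_le _ _)
    intro ω hω
    by_cases hg : ω ∈ G n
    · exact Or.inl ((h1 ω hg).1 hω)
    · exact Or.inr hg
  have u2 : (Q n).real {ω | |S n ω| ≤ φ - δ / 2} ≤ (Q n).real (C n) + (Q n).real (G n)ᶜ := by
    refine (measureReal_mono ?_).trans (measureReal_union_le _ _)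
    intro ω hω
    by_cases hg : ω ∈ G n
    · exact Or.inl ((h1 ω hg).2 hω)
    · exact Or.inr hg
  rw [Real.dist_eq, abs_lt]
  constructor <;> linarith

/-! ### Conditional law of the edges given the train network -/

/-- The conditional mean of a `Bernoulli m` edge given that its noisy copy has the value `s`. -/
noncomputable def condMean (γ : ℝ) (s : Fin 2) (m : ℝ) : ℝ :=
  m * Real.exp (shift γ s) / (m * Real.exp (shift γ s) + (1 - m))

/-- Independence is the statement that the joint law is a product measure; regrouping coordinates
from `ι ⊕ ι` into pairs carries one product measure to the other. -/
lemma iIndepFun_prodMk_of_sumElim {Ω ι : Type*} [MeasurableSpace Ω] {P : Measure Ω}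
    [IsProbabilityMeasure P] [Fintype ι] {X Y : ι → Ω → ℝ} (hX : ∀ i, Measurable (X i))
    (hY : ∀ i, Measurable (Y i)) (h : iIndepFun (Sum.elim X Y) P) :
    iIndepFun (fun i ω => (X i ω, Y i ω)) P := by
  have hZ : ∀ x, AEMeasurable (Sum.elim X Y x) P := by
    rintro (i | i)
    exacts [(hX i).aemeasurable, (hY i).aemeasurable]
  have pX : ∀ i, IsProbabilityMeasure (P.map (X i)) := fun i =>
    Measure.isProbabilityMeasure_map (hX i).aemeasurable
  have pY : ∀ i, IsProbabilityMeasure (P.map (Y i)) := fun i =>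
    Measure.isProbabilityMeasure_map (hY i).aemeasurable
  have pZ : ∀ x, IsProbabilityMeasure (P.map (Sum.elim X Y x)) := fun x =>
    Measure.isProbabilityMeasure_map (hZ x)
  have h1 := (iIndepFun_iff_map_fun_eq_pi_map hZ).1 h
  rw [iIndepFun_iff_map_fun_eq_pi_map fun i => ((hX i).prodMk (hY i)).aemeasurable]
  have h2 : ∀ i, P.map (fun ω => (X i ω, Y i ω)) = (P.map (X i)).prod (P.map (Y i)) := fun i =>
    (indepFun_iff_map_prod_eq_prod_map_map (hX i).aemeasurable (hY i).aemeasurable).1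
      (h.indepFun (i := Sum.inl i) (j := Sum.inr i) (by simp))
  simp_rw [h2]
  have e1 := measurePreserving_sumPiEquivProdPi (fun x => P.map (Sum.elim X Y x))
  have e2 := (measurePreserving_arrowProdEquivProdArrow ℝ ℝ ι (fun i => P.map (X i))
    (fun i => P.map (Y i))).symm
  have e3 := (e2.comp e1).map_eq
  rw [← h1, Measure.map_map ((MeasurableEquiv.measurable _).comp (MeasurableEquiv.measurable _))
    (measurable_pi_iff.2 fun x => by rcases x with i | i; exacts [hX i, hY i])] at e3
  exact e3

section Bernoulli

variable {Ω : Type*} [MeasurableSpace Ω] {P : Measure Ω} {X W : Ω → ℝ} {m γ : ℝ}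

lemma IsBernoulli.ae_eq_zero_or_one (h : IsBernoulli X m P) : ∀ᵐ ω ∂P, X ω = 0 ∨ X ω = 1 := by
  obtain ⟨hp, hX⟩ := h
  have hs : MeasurableSet {x : ℝ | x = 0 ∨ x = 1} :=
    (measurableSet_singleton 0).union (measurableSet_singleton 1)
  have h2 : ∀ᵐ x ∂(P.map X), x = 0 ∨ x = 1 := by
    rw [hX.map_eq, bernoulliMeasure_def, ae_iff]
    simp
  exact (ae_map_iff hX.aemeasurable hs).1 h2

lemma IsBernoulli.measureReal_eq_one (h : IsBernoulli X m P) : P.real {ω | X ω = 1} = m := by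
  obtain ⟨hp, hX⟩ := h
  have hs : {x : ℝ | x = 1} = {1} := rfl
  rw [hX.measureReal_eq (p := fun x => x = 1) (measurableSet_singleton 1), hs]
  classical
  rw [bernoulliMeasure_real_apply _ (measurableSet_singleton 1)]
  simp

lemma IsBernoulli.measureReal_eq_zero (h : IsBernoulli X m P) :
    P.real {ω | X ω = 0} = 1 - m := by
  obtain ⟨hp, hX⟩ := h
  have hs : {x : ℝ | x = 0} = {0} := rfl
  rw [hX.measureReal_eq (p := fun x => x = 0) (measurableSet_singleton 0), hs]
  classical
  rw [bernoulliMeasure_real_apply _ (measurableSet_singleton 0)]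
  simp

lemma IsBernoulli.integral_eq (h : IsBernoulli X m P) : ∫ ω, X ω ∂P = m := by
  obtain ⟨hp, hX⟩ := h
  rw [hX.integral_eq, integral_bernoulliMeasure]
  simp

lemma integral_eq_measureReal_of_ae (hX : Measurable X) (h : ∀ᵐ ω ∂P, X ω = 0 ∨ X ω = 1) :
    ∫ ω, X ω ∂P = P.real {ω | X ω = 1} := by
  have : X =ᵐ[P] {ω | X ω = 1}.indicator 1 := by
    filter_upwards [h] with ω hω
    rcases hω with hω | hω <;> simp [Set.indicator, hω]
  rw [integral_congr_ae this]
  exact integral_indicator_one (hX (measurableSet_singleton 1))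

lemma condMean_eq (hγ : γ ∈ Set.Ioo (0 : ℝ) (1 / 2)) (m : ℝ) :
    condMean γ 0 m = m * γ / (m * γ + (1 - m) * (1 - γ)) ∧
    condMean γ 1 m = m * (1 - γ) / (m * (1 - γ) + (1 - m) * γ) := by
  have h0 : 0 < γ := hγ.1
  have h1 : 0 < 1 - γ := by linarith [hγ.2]
  constructor
  · rw [condMean, shift, if_pos rfl, Real.exp_log (by positivity)]
    rw [← mul_div_mul_right _ _ h1.ne']
    congr 1 <;> field_simp
  · rw [condMean, shift, if_neg (by simp), Real.exp_log (by positivity)]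
    rw [← mul_div_mul_right _ _ h0.ne']
    congr 1 <;> field_simp

/-- Bayes' rule for one edge and its noisy copy. -/
lemma cond_measureReal_eq_condMean [IsProbabilityMeasure P] (hX : Measurable X) (hW : Measurable W)
    (bX : IsBernoulli X m P) (bW : IsBernoulli W γ P) (hXW : IndepFun X W P)
    (hγ : γ ∈ Set.Ioo (0 : ℝ) (1 / 2)) (s : Fin 2) :
    (cond P ((fun ω => X ω * (1 - W ω) + (1 - X ω) * W ω) ⁻¹' {((s : ℕ) : ℝ)})).real
      {ω | X ω = 1} = condMean γ s m := by
  set T := fun ω => X ω * (1 - W ω) + (1 - X ω) * W ω with hT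
  have mT : Measurable T := by fun_prop
  set r : ℝ := ((s : ℕ) : ℝ) with hr
  have mr : MeasurableSet (T ⁻¹' {r}) := mT (measurableSet_singleton r)
  have ind : ∀ x w : ℝ, P.real ({ω | X ω = x} ∩ {ω | W ω = w})
      = P.real {ω | X ω = x} * P.real {ω | W ω = w} := fun x w => by
    have := hXW.measure_inter_preimage_eq_mul {x} {w} (measurableSet_singleton x)
      (measurableSet_singleton w)
    simp only [measureReal_def, ← ENNReal.toReal_mul]
    exact congrArg ENNReal.toReal this
  -- Given `X = 1` the noisy copy is `1 - W`; given `X = 0` it is `W`. These are the two terms of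
  -- Bayes' formula.
  have e1 : P.real (T ⁻¹' {r} ∩ {ω | X ω = 1}) = m * P.real {ω | W ω = 1 - r} := by
    rw [← bX.measureReal_eq_one, ← ind]
    congr 1
    ext ω
    simp only [hT, Set.mem_inter_iff, Set.mem_preimage, Set.mem_singleton_iff, Set.mem_ofPred_eq]
    constructor
    · rintro ⟨h1, h2⟩
      rw [h2] at h1
      exact ⟨h2, by linarith⟩
    · rintro ⟨h1, h2⟩
      rw [h1, h2]
      exact ⟨by ring, rfl⟩
  have e2 : P.real (T ⁻¹' {r} ∩ {ω | X ω = 0}) = (1 - m) * P.real {ω | W ω = r} := by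
    rw [← bX.measureReal_eq_zero, ← ind]
    congr 1
    ext ω
    simp only [hT, Set.mem_inter_iff, Set.mem_preimage, Set.mem_singleton_iff, Set.mem_ofPred_eq]
    constructor
    · rintro ⟨h1, h2⟩
      rw [h2] at h1
      exact ⟨h2, by linarith⟩
    · rintro ⟨h1, h2⟩
      rw [h1, h2]
      exact ⟨by ring, rfl⟩
  have e3 : P.real (T ⁻¹' {r}) = m * P.real {ω | W ω = 1 - r} + (1 - m) * P.real {ω | W ω = r} := by
    rw [← e1, ← e2, ← measureReal_union]
    · refine measureReal_congr ?_
      filter_upwards [bX.ae_eq_zero_or_one] with ω hω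
      refine propext ⟨fun h => ?_, fun h => ?_⟩
      · rcases hω with h0 | h0
        · exact Or.inr ⟨h, h0⟩
        · exact Or.inl ⟨h, h0⟩
      · rcases h with h | h <;> exact h.1
    · rw [Set.disjoint_left]
      rintro ω ⟨_, h1⟩ ⟨_, h2⟩
      simp only [Set.mem_ofPred_eq] at h1 h2
      linarith
    · exact mr.inter (hX (measurableSet_singleton 0))
  rw [measureReal_def, cond_apply mr, ENNReal.toReal_mul, ENNReal.toReal_inv, ← measureReal_def,
    ← measureReal_def, e1, e3]
  have b1 := bW.measureReal_eq_one
  have b0 := bW.measureReal_eq_zero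
  obtain ⟨c0, c1⟩ := condMean_eq hγ m
  fin_cases s
  · have hr : r = 0 := by simp [hr]
    rw [hr, sub_zero, b1, b0]
    simp only [Fin.zero_eta, c0]
    field_simp
  · have hr : r = 1 := by simp [hr]
    rw [hr, sub_self, b1, b0]
    simp only [Fin.mk_one, c1]
    field_simp

end Bernoulli

lemma setOf_train_eq {Ω : Type*} {n : ℕ} {A W : Ω → Matrix (Fin n) (Fin n) ℝ}
    (a : Matrix (Fin n) (Fin n) ℝ) :
    {ω | train (A ω) (W ω) = a} = ⋂ p : Fin n × Fin n, (fun ω => A ω p.1 p.2 * (1 - W ω p.1 p.2)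
      + (1 - A ω p.1 p.2) * W ω p.1 p.2) ⁻¹' {a p.1 p.2} := by
  ext ω
  simp [train, ← Matrix.ext_iff]

section Conditioning

variable {Ω : Type*} [MeasurableSpace Ω] {P : Measure Ω} [IsProbabilityMeasure P] {n : ℕ}
  {M : Matrix (Fin n) (Fin n) ℝ} {γ : ℝ} {A W : Ω → Matrix (Fin n) (Fin n) ℝ}

/-- Conditioning on an event of an independent variable does not change the sampling model. -/
lemma IsBernoulliModel.cond_of_indepFun (h : IsBernoulliModel P M γ A W) {E : Type*}
    [MeasurableSpace E] {aux : Ω → E} (haux : Measurable aux)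
    (hind : IndepFun aux (fun ω x => entries A W x ω) P) {D : Set E} (hD : MeasurableSet D)
    (hPD : P (aux ⁻¹' D) ≠ 0) : IsBernoulliModel (cond P (aux ⁻¹' D)) M γ A W := by
  have mF : Measurable fun ω x => entries A W x ω := measurable_pi_iff.2 h.measurable
  have hQ : IsProbabilityMeasure (cond P (aux ⁻¹' D)) := cond_isProbabilityMeasure hPD
  -- Every clause of the model other than measurability concerns only the joint law of the entries,
  -- so it suffices that this law is unchanged.
  have hmap : (cond P (aux ⁻¹' D)).map (fun ω x => entries A W x ω)
      = P.map (fun ω x => entries A W x ω) := by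
    ext S hS
    rw [Measure.map_apply mF hS, Measure.map_apply mF hS, cond_apply (haux hD),
      hind.measure_inter_preimage_eq_mul D S hD hS, ← mul_assoc,
      ENNReal.inv_mul_cancel hPD (measure_ne_top _ _), one_mul]
  have hmap' : ∀ x, (cond P (aux ⁻¹' D)).map (entries A W x) = P.map (entries A W x) := fun x => by
    have := congrArg (fun ν => ν.map (Function.eval x)) hmap
    rwa [Measure.map_map (measurable_pi_apply x) mF, Measure.map_map (measurable_pi_apply x) mF]
      at this
  refine ⟨h.measurable, fun i j => ?_, fun i j => ?_, ?_⟩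
  · obtain ⟨hp, hX⟩ := h.edge_law i j
    exact ⟨hp, (h.measurable (Sum.inl (i, j))).aemeasurable,
      (hmap' (Sum.inl (i, j))).trans hX.map_eq⟩
  · obtain ⟨hp, hX⟩ := h.toggle_law i j
    exact ⟨hp, (h.measurable (Sum.inr (i, j))).aemeasurable,
      (hmap' (Sum.inr (i, j))).trans hX.map_eq⟩
  · rw [iIndepFun_iff_map_fun_eq_pi_map fun x => (h.measurable x).aemeasurable, hmap]
    simp_rw [hmap']
    exact (iIndepFun_iff_map_fun_eq_pi_map fun x => (h.measurable x).aemeasurable).1 h.indep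

/-- Given the train network, the edges are independent, with the means of Bayes' rule. -/
lemma IsBernoulliModel.cond_train (h : IsBernoulliModel P M γ A W)
    (hγ : γ ∈ Set.Ioo (0 : ℝ) (1 / 2)) {a : Matrix (Fin n) (Fin n) ℝ}
    (ha : P {ω | train (A ω) (W ω) = a} ≠ 0) :
    iIndepFun (fun (p : Fin n × Fin n) ω => A ω p.1 p.2) (cond P {ω | train (A ω) (W ω) = a}) ∧
    (∀ p : Fin n × Fin n, ∃ s : Fin 2, a p.1 p.2 = ((s : ℕ) : ℝ)) ∧
    ∀ (p : Fin n × Fin n) (s : Fin 2), a p.1 p.2 = ((s : ℕ) : ℝ) →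
      ∫ ω, A ω p.1 p.2 ∂(cond P {ω | train (A ω) (W ω) = a}) = condMean γ s (M p.1 p.2) := by
  classical
  have mA : ∀ p : Fin n × Fin n, Measurable fun ω => A ω p.1 p.2 := fun p =>
    h.measurable (Sum.inl p)
  have mW : ∀ p : Fin n × Fin n, Measurable fun ω => W ω p.1 p.2 := fun p =>
    h.measurable (Sum.inr p)
  set T : Fin n × Fin n → Ω → ℝ := fun p ω => A ω p.1 p.2 * (1 - W ω p.1 p.2)
      + (1 - A ω p.1 p.2) * W ω p.1 p.2 with hT
  have mT : ∀ p, Measurable (T p) := fun p =>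
    ((mA p).mul ((mW p).const_sub 1)).add (((mA p).const_sub 1).mul (mW p))
  have hev : {ω | train (A ω) (W ω) = a} = ⋂ p, T p ⁻¹' {a p.1 p.2} := setOf_train_eq a
  have hpair : iIndepFun (fun (p : Fin n × Fin n) ω => (A ω p.1 p.2, W ω p.1 p.2)) P :=
    iIndepFun_prodMk_of_sumElim mA mW h.indep
  -- The pairs (edge, train value) are independent across dyads, and the conditioning event
  -- constrains each train value separately; hence the edges stay independent.
  have hAT : iIndepFun (fun p ω => (A ω p.1 p.2, T p ω)) P :=
    hpair.comp (fun _ x => (x.1, x.1 * (1 - x.2) + (1 - x.1) * x.2)) fun _ => by fun_prop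
  rw [hev] at ha ⊢
  have hne : ∀ p, P (T p ⁻¹' {a p.1 p.2}) ≠ 0 := fun p h0 =>
    ha (measure_mono_null (Set.iInter_subset _ p) h0)
  have hms : ∀ p : Fin n × Fin n, MeasurableSet {a p.1 p.2} := fun p => measurableSet_singleton _
  have h01 : ∀ p : Fin n × Fin n,
      ∀ᵐ ω ∂(cond P (⋂ p, T p ⁻¹' {a p.1 p.2})), A ω p.1 p.2 = 0 ∨ A ω p.1 p.2 = 1 := fun p =>
    cond_absolutelyContinuous.ae_le (h.edge_law p.1 p.2).ae_eq_zero_or_one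
  refine ⟨hAT.cond mT hne hms, fun p => ?_, fun p s hs => ?_⟩
  -- An event of positive probability meets the almost sure event that edge and toggle are 0 or 1,
  -- so the realized train value is 0 or 1.
  · have : ∃ᵐ ω ∂P, ω ∈ T p ⁻¹' {a p.1 p.2} := frequently_ae_mem_iff.2 (hne p)
    obtain ⟨ω, h1, h2, h3⟩ := (this.and_eventually ((h.edge_law p.1 p.2).ae_eq_zero_or_one.and
      (h.toggle_law p.1 p.2).ae_eq_zero_or_one)).exists
    have h4 : T p ω = a p.1 p.2 := h1
    rw [← h4]
    rcases h2 with h2 | h2 <;> rcases h3 with h3 | h3 <;> simp [hT, h2, h3]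
  · rw [integral_eq_measureReal_of_ae (mA p) (h01 p),
      ← cond_measureReal_eq_condMean (mA p) (mW p) (h.edge_law p.1 p.2) (h.toggle_law p.1 p.2)
        (h.indep.indepFun (i := Sum.inl p) (j := Sum.inr p) (by simp)) hγ s, ← hs]
    -- For the single edge `p`, conditioning on all train values reduces to conditioning on its own,
    -- where Bayes' rule applies.
    have := cond_iInter (s := {p}) mT hAT
      (f := fun p => {ω | A ω p.1 p.2 = 1}) (t := fun p => {a p.1 p.2})
      (fun i _ => ⟨{1}, measurableSet_singleton 1, rfl⟩) (fun i _ => hne i) hms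
    simp only [Finset.mem_singleton, Set.iInter_iInter_eq_left, Finset.prod_singleton] at this
    rw [measureReal_def, measureReal_def, this]

end Conditioning

/-! ### The debiasing map and its delta-method variance -/

/-- The map that recovers the mean of an edge from its conditional mean, with `e` the odds ratio. -/
noncomputable def debias (e x : ℝ) : ℝ := x / (x + (1 - x) * e)

/-- The derivative of `debias e` at `x`. -/
noncomputable def debiasDeriv (e x : ℝ) : ℝ := e / (x + (1 - x) * e) ^ 2

/-- The variance that the delta method gives for one debiased Bernoulli variable of mean `x`. -/
noncomputable def debiasVar (e x : ℝ) : ℝ := debiasDeriv e x ^ 2 * (x * (1 - x))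

section Analytic

variable {l h e x y t₀ : ℝ}

/-- The denominator is a convex combination of 1 and `e`, both in `[l, h]`. -/
lemma debias_denom_mem (he : e ∈ Set.Icc l h) (hl : l ≤ 1) (hh : 1 ≤ h)
    (hx : x ∈ Set.Icc (0 : ℝ) 1) : x + (1 - x) * e ∈ Set.Icc l h := by
  obtain ⟨h1, h2⟩ := he
  obtain ⟨h3, h4⟩ := hx
  constructor <;> nlinarith

lemma abs_debias_sub_le (hl0 : 0 < l) (he : e ∈ Set.Icc l h) (hl : l ≤ 1) (hh : 1 ≤ h)
    (hx : x ∈ Set.Icc (0 : ℝ) 1) (hy : y ∈ Set.Icc (0 : ℝ) 1) :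
    |debias e x - debias e y - debiasDeriv e y * (x - y)|
      ≤ h * (1 + h) / l ^ 3 * (x - y) ^ 2 := by
  have hdx := debias_denom_mem he hl hh hx
  have hdy := debias_denom_mem he hl hh hy
  set dx := x + (1 - x) * e with edx
  set dy := y + (1 - y) * e with edy
  have px : 0 < dx := hl0.trans_le hdx.1
  have py : 0 < dy := hl0.trans_le hdy.1
  have pe : 0 < e := hl0.trans_le he.1
  -- For this fractional linear map the first-order Taylor remainder has an exact closed form.
  have key : debias e x - debias e y - debiasDeriv e y * (x - y)
      = -(e * (1 - e) / (dx * dy ^ 2)) * (x - y) ^ 2 := by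
    have e1 : debias e x - debias e y = e * (x - y) / (dx * dy) := by
      rw [debias, debias, ← edx, ← edy, div_sub_div _ _ px.ne' py.ne']
      congr 1
      rw [edx, edy]; ring
    rw [e1, debiasDeriv, ← edy]
    field_simp
    rw [edx, edy]; ring
  rw [key, abs_mul, abs_neg, abs_of_nonneg (sq_nonneg (x - y))]
  refine mul_le_mul_of_nonneg_right ?_ (sq_nonneg _)
  rw [abs_div, abs_mul, abs_of_pos pe, abs_of_pos (by positivity : 0 < dx * dy ^ 2)]
  have h1 : |1 - e| ≤ 1 + h := by
    rw [abs_le]; constructor <;> linarith [he.2]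
  have h2 : l ^ 3 ≤ dx * dy ^ 2 := by
    calc l ^ 3 = l * l ^ 2 := by ring
      _ ≤ dx * dy ^ 2 := by gcongr; exacts [hdx.1, hdy.1]
  have h3 : 0 ≤ h := by linarith
  gcongr
  exact he.2

lemma abs_debiasDeriv_le (hl0 : 0 < l) (he : e ∈ Set.Icc l h) (hl : l ≤ 1) (hh : 1 ≤ h)
    (hx : x ∈ Set.Icc (0 : ℝ) 1) : |debiasDeriv e x| ≤ h / l ^ 2 := by
  have hdx := debias_denom_mem he hl hh hx
  have px := hl0.trans_le hdx.1
  have pe : 0 < e := hl0.trans_le he.1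
  rw [debiasDeriv, abs_of_pos (by positivity)]
  have h3 : 0 ≤ h := by linarith
  gcongr
  exacts [he.2, hdx.1]

lemma debiasVar_nonneg (hx : x ∈ Set.Icc (0 : ℝ) 1) : 0 ≤ debiasVar e x :=
  mul_nonneg (sq_nonneg _) (mul_nonneg hx.1 (by linarith [hx.2]))

lemma le_debiasVar (hl0 : 0 < l) (he : e ∈ Set.Icc l h) (hl : l ≤ 1) (hh : 1 ≤ h)
    (ht : 0 < t₀) (hx : x ∈ Set.Icc t₀ (1 - t₀)) :
    (l / h ^ 2) ^ 2 * (t₀ * t₀) ≤ debiasVar e x := by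
  have hx' : x ∈ Set.Icc (0 : ℝ) 1 := ⟨ht.le.trans hx.1, by linarith [hx.2]⟩
  have hdx := debias_denom_mem he hl hh hx'
  have px := hl0.trans_le hdx.1
  have h3 : 0 ≤ h := by linarith
  have pe : 0 ≤ e := hl0.le.trans he.1
  rw [debiasVar, debiasDeriv]
  gcongr
  exacts [he.1, hdx.2, hx'.1, hx.1, by linarith [hx.2]]

/-- Uniform continuity on a compact rectangle; one modulus `η` serves all cells and all `n`. -/
lemma exists_abs_debiasVar_sub_le (hl0 : 0 < l) (hl : l ≤ 1) (hh : 1 ≤ h) {ρ : ℝ} (hρ : 0 < ρ) :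
    ∃ η > 0, ∀ e ∈ Set.Icc l h, ∀ x ∈ Set.Icc (0 : ℝ) 1, ∀ y ∈ Set.Icc (0 : ℝ) 1,
      |x - y| ≤ η → |debiasVar e x - debiasVar e y| ≤ ρ := by
  have hc : ContinuousOn (fun q : ℝ × ℝ => debiasVar q.1 q.2)
      (Set.Icc l h ×ˢ Set.Icc (0 : ℝ) 1) := by
    unfold debiasVar debiasDeriv
    refine ContinuousOn.mul (ContinuousOn.pow (ContinuousOn.div (by fun_prop) (by fun_prop) ?_) 2)
      (by fun_prop)
    rintro ⟨e, x⟩ ⟨he, hx⟩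
    exact pow_ne_zero 2 (hl0.trans_le (debias_denom_mem he hl hh hx).1).ne'
  have hu := (isCompact_Icc.prod isCompact_Icc).uniformContinuousOn_of_continuous hc
  obtain ⟨η, hη, H⟩ := Metric.uniformContinuousOn_iff.1 hu ρ hρ
  refine ⟨η / 2, by positivity, fun e he x hx y hy hxy => ?_⟩
  have := H (e, x) ⟨he, hx⟩ (e, y) ⟨he, hy⟩ (by
    rw [Prod.dist_eq, dist_self, max_lt_iff, Real.dist_eq]
    exact ⟨hη, by simpa using lt_of_le_of_lt hxy (by linarith)⟩)
  rw [Real.dist_eq] at this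
  exact this.le

end Analytic

/-! ### Averages of independent zero-one variables -/

/-- Independent `{0,1}`-valued random variables with given means. -/
structure IsIndepZeroOne {Ω ι : Type*} [MeasurableSpace Ω] (Q : Measure Ω) (X : ι → Ω → ℝ)
    (T : ι → ℝ) : Prop where
  measurable : ∀ p, Measurable (X p)
  indep : iIndepFun X Q
  zero_or_one : ∀ p, ∀ᵐ ω ∂Q, X p ω = 0 ∨ X p ω = 1
  integral_eq : ∀ p, ∫ ω, X p ω ∂Q = T p

namespace IsIndepZeroOne

variable {Ω ι : Type*} [MeasurableSpace Ω] {Q : Measure Ω} [IsProbabilityMeasure Q]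
  {X : ι → Ω → ℝ} {T : ι → ℝ}

lemma integrable (hX : IsIndepZeroOne Q X T) (p : ι) : Integrable (X p) Q := by
  refine Integrable.of_bound (hX.measurable p).aestronglyMeasurable 1 ?_
  filter_upwards [hX.zero_or_one p] with ω hω
  rcases hω with hω | hω <;> simp [hω]

lemma mean_mem (hX : IsIndepZeroOne Q X T) (p : ι) : T p ∈ Set.Icc (0 : ℝ) 1 := by
  rw [← hX.integral_eq p]
  constructor
  · refine integral_nonneg_of_ae ?_
    filter_upwards [hX.zero_or_one p] with ω hω
    rcases hω with hω | hω <;> simp [hω]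
  · calc ∫ ω, X p ω ∂Q ≤ ∫ _, (1 : ℝ) ∂Q := by
          refine integral_mono_ae (hX.integrable p) (integrable_const _) ?_
          filter_upwards [hX.zero_or_one p] with ω hω
          rcases hω with hω | hω <;> simp [hω]
      _ = 1 := by simp

lemma integral_sub_mean (hX : IsIndepZeroOne Q X T) (p : ι) : ∫ ω, (X p ω - T p) ∂Q = 0 := by
  rw [integral_sub (hX.integrable p) (integrable_const _), hX.integral_eq]
  simp

lemma integral_sub_mean_sq (hX : IsIndepZeroOne Q X T) (p : ι) :
    ∫ ω, (X p ω - T p) ^ 2 ∂Q = T p * (1 - T p) := by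
  have : (fun ω => (X p ω - T p) ^ 2) =ᵐ[Q] fun ω => (1 - 2 * T p) * X p ω + T p ^ 2 := by
    filter_upwards [hX.zero_or_one p] with ω hω
    rcases hω with hω | hω <;> simp only [hω] <;> ring
  rw [integral_congr_ae this, integral_add ((hX.integrable p).const_mul _) (integrable_const _),
    integral_const_mul, hX.integral_eq]
  simp
  ring

lemma memLp (hX : IsIndepZeroOne Q X T) (p : ι) : MemLp (X p) 2 Q := by
  refine MemLp.of_bound (hX.measurable p).aestronglyMeasurable 1 ?_
  filter_upwards [hX.zero_or_one p] with ω hω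
  rcases hω with hω | hω <;> simp [hω]

lemma variance_le (hX : IsIndepZeroOne Q X T) (p : ι) : variance (X p) Q ≤ 1 := by
  rw [variance_eq_integral (hX.measurable p).aemeasurable, hX.integral_eq,
    hX.integral_sub_mean_sq]
  have := hX.mean_mem p
  nlinarith [this.1, this.2]

/-- Chebyshev's inequality for the average over a finite set on which the mean is constant. -/
lemma measureReal_lt_abs_sub_le (hX : IsIndepZeroOne Q X T) {S : Finset ι} (hS : S.Nonempty)
    {τ : ℝ} (hτ : ∀ p ∈ S, T p = τ) {r : ℝ} (hr : 0 < r) :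
    Q.real {ω | r < |(∑ p ∈ S, X p ω) / S.card - τ|} ≤ 1 / (S.card * r ^ 2) := by
  have hm : (0 : ℝ) < S.card := by exact_mod_cast hS.card_pos
  have hmean : ∫ ω, (∑ p ∈ S, X p) ω ∂Q = S.card * τ := by
    simp only [Finset.sum_apply]
    rw [integral_finsetSum _ fun p _ => hX.integrable p]
    simp_rw [hX.integral_eq]
    rw [Finset.sum_congr rfl hτ]
    simp
  have hvar : variance (∑ p ∈ S, X p) Q ≤ S.card := by
    rw [IndepFun.variance_sum (fun p _ => hX.memLp p)
      (fun p _ q _ hpq => hX.indep.indepFun hpq)]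
    calc _ ≤ ∑ p ∈ S, (1 : ℝ) := Finset.sum_le_sum fun p _ => hX.variance_le p
      _ = _ := by simp
  have hL : MemLp (∑ p ∈ S, X p) 2 Q := memLp_finsetSum' _ fun p _ => hX.memLp p
  have hc := meas_ge_le_variance_div_sq hL (c := S.card * r) (by positivity)
  rw [hmean] at hc
  calc _ ≤ Q.real {ω | S.card * r ≤ |(∑ p ∈ S, X p) ω - S.card * τ|} := by
        refine measureReal_mono fun ω hω => ?_
        have hω' : r < |(∑ p ∈ S, X p ω) / S.card - τ| := hω
        change S.card * r ≤ |(∑ p ∈ S, X p) ω - S.card * τ|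
        have e1 : (∑ p ∈ S, X p) ω - S.card * τ
            = S.card * ((∑ p ∈ S, X p ω) / S.card - τ) := by
          rw [Finset.sum_apply]; field_simp
        rw [e1, abs_mul, abs_of_pos hm]
        exact mul_le_mul_of_nonneg_left hω'.le hm.le
    _ ≤ variance (∑ p ∈ S, X p) Q / (S.card * r) ^ 2 := by
        refine ENNReal.toReal_le_of_le_ofReal ?_ hc
        exact div_nonneg (variance_nonneg _ _) (sq_nonneg _)
    _ ≤ S.card / (S.card * r) ^ 2 := by gcongr
    _ = _ := by field_simp

end IsIndepZeroOne

/-! ### Weighted sums of debiased block means -/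

noncomputable def blockMean {ι : Type*} (S : Finset ι) (x : ι → ℝ) : ℝ :=
  (∑ p ∈ S, x p) / (S.card : ℝ)

/-- The variance of the weighted sum of debiased block means, as a function of the block means. -/
noncomputable def blockVar {ι J : Type*} [Fintype J] (S : J → Finset ι) (c e y : J → ℝ) : ℝ :=
  ∑ j, c j ^ 2 * (debiasVar (e j) (y j) / ((S j).card : ℝ))

/-- Disjoint blocks of size comparable to `N ^ 2`, with bounded weights `c` that do not all vanish,
and with constant means `τ j ∈ [t₀, 1 - t₀]` on the blocks of nonzero weight. -/
structure IsBalanced {ι J : Type*} [Fintype J] (N κ t₀ : ℝ) (S : J → Finset ι) (c τ : J → ℝ)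
    (T : ι → ℝ) : Prop where
  disjoint : ∀ i j, i ≠ j → Disjoint (S i) (S j)
  card_le : ∀ j, ((S j).card : ℝ) ≤ N ^ 2
  le_card : ∀ j, κ * N ^ 2 ≤ ((S j).card : ℝ)
  abs_le : ∀ j, |c j| ≤ 1
  le_sum_sq : κ ≤ ∑ j, c j ^ 2
  mem : ∀ j, τ j ∈ Set.Icc t₀ (1 - t₀)
  mean : ∀ j, c j ≠ 0 → ∀ p ∈ S j, T p = τ j

/-- The weight of one edge in the linear part of the estimation error. -/
noncomputable def scoreWeight {ι J : Type*} [Fintype J] (S : J → Finset ι) (c e τ : J → ℝ)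
    (p : ι) : ℝ :=
  ∑ j, (S j : Set ι).indicator
    (fun _ => c j * debiasDeriv (e j) (τ j) / ((S j).card : ℝ)) p

lemma blockMean_mem {ι : Type*} {S : Finset ι} {x : ι → ℝ}
    (hx : ∀ p, x p = 0 ∨ x p = 1) : blockMean S x ∈ Set.Icc (0 : ℝ) 1 := by
  have h0 : ∀ p ∈ S, 0 ≤ x p := fun p _ => by rcases hx p with h | h <;> simp [h]
  have h1 : ∀ p ∈ S, x p ≤ 1 := fun p _ => by rcases hx p with h | h <;> simp [h]
  refine ⟨div_nonneg (Finset.sum_nonneg h0) (Nat.cast_nonneg _),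
    div_le_one_of_le₀ ?_ (Nat.cast_nonneg _)⟩
  simpa using Finset.sum_le_sum h1

lemma abs_sqrt_sub_sqrt_le {x y r : ℝ} (hx : 0 ≤ x) (hy : 0 < y) (h : |x - y| ≤ r * y) :
    |√x - √y| ≤ r * √y := by
  have hy' : 0 < √y := Real.sqrt_pos.2 hy
  have e : x - y = (√x - √y) * (√x + √y) := by
    have h1 := Real.sq_sqrt hx
    have h2 := Real.sq_sqrt hy.le
    nlinarith
  have h2 : |√x - √y| * √y ≤ r * √y * √y := by
    calc |√x - √y| * √y ≤ |√x - √y| * (√x + √y) := by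
          gcongr; linarith [Real.sqrt_nonneg x]
      _ = |x - y| := by rw [e, abs_mul, abs_of_nonneg (by positivity : 0 ≤ √x + √y)]
      _ ≤ r * √y * √y := by rw [mul_assoc, Real.mul_self_sqrt hy.le]; exact h
  exact le_of_mul_le_mul_right h2 hy'

/-- Here `F` is the error, `L` its linear part, `s` the true and `σ` the estimated standard
deviation. Replacing `σ` by `s` moves the threshold by `φ * r₁`, and replacing `F` by `L` by `r₂`,
in units of `s`. No division by the random `σ` occurs. -/
lemma abs_le_iff_up_to {L F s σ φ δ r₁ r₂ : ℝ} (hs : 0 < s) (hF : |F - L| ≤ r₂ * s)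
    (hσ : |σ - s| ≤ r₁ * s) (hφ : 0 ≤ φ) (hδ : φ * r₁ + r₂ ≤ δ) :
    (|F| ≤ φ * σ → |L / s| ≤ φ + δ) ∧ (|L / s| ≤ φ - δ → |F| ≤ φ * σ) := by
  rw [abs_div, abs_of_pos hs, div_le_iff₀ hs, div_le_iff₀ hs]
  have h1 : φ * σ ≤ φ * (s + r₁ * s) :=
    mul_le_mul_of_nonneg_left (by linarith [(abs_le.1 hσ).2]) hφ
  have h2 : φ * (s - r₁ * s) ≤ φ * σ :=
    mul_le_mul_of_nonneg_left (by linarith [(abs_le.1 hσ).1]) hφ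
  have h3 : (φ * r₁ + r₂) * s ≤ δ * s := mul_le_mul_of_nonneg_right hδ hs.le
  have h4 : |L| ≤ |F| + |F - L| := by
    have := abs_sub_abs_le_abs_sub L F
    rw [abs_sub_comm] at this
    linarith
  have h5 : |F| ≤ |L| + |F - L| := by
    have := abs_sub_abs_le_abs_sub F L
    linarith
  constructor <;> intro h <;> nlinarith

namespace IsBalanced

variable {ι J : Type*} [Fintype J] {N κ t₀ l h : ℝ} {S : J → Finset ι} {c e τ : J → ℝ} {T : ι → ℝ}

lemma card_pos (H : IsBalanced N κ t₀ S c τ T) (hκ : 0 < κ) (hN : 0 < N) (j : J) :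
    (0 : ℝ) < (S j).card := lt_of_lt_of_le (by positivity) (H.le_card j)

lemma mem_unit (H : IsBalanced N κ t₀ S c τ T) (ht₀ : 0 < t₀) (j : J) :
    τ j ∈ Set.Icc (0 : ℝ) 1 := ⟨ht₀.le.trans (H.mem j).1, by linarith [(H.mem j).2]⟩

lemma sq_le (H : IsBalanced N κ t₀ S c τ T) (j : J) : c j ^ 2 ≤ 1 :=
  (sq_le_one_iff_abs_le_one _).2 (H.abs_le j)

/-- This puts the standard deviation at order at least `1 / N`, the scale against which the
remainder and the single summands must be small. -/
lemma le_blockVar (H : IsBalanced N κ t₀ S c τ T) (hκ : 0 < κ) (hN : 0 < N) (ht₀ : 0 < t₀)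
    (hl0 : 0 < l) (hl : l ≤ 1) (hh : 1 ≤ h) (he : ∀ j, e j ∈ Set.Icc l h) :
    κ * ((l / h ^ 2) ^ 2 * (t₀ * t₀)) / N ^ 2 ≤ blockVar S c e τ := by
  calc κ * ((l / h ^ 2) ^ 2 * (t₀ * t₀)) / N ^ 2
      ≤ (∑ j, c j ^ 2) * ((l / h ^ 2) ^ 2 * (t₀ * t₀)) / N ^ 2 := by
        gcongr
        exact H.le_sum_sq
    _ = ∑ j, c j ^ 2 * ((l / h ^ 2) ^ 2 * (t₀ * t₀) / N ^ 2) := by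
        rw [← Finset.sum_mul]; ring
    _ ≤ _ := by
        refine Finset.sum_le_sum fun j _ => mul_le_mul_of_nonneg_left ?_ (sq_nonneg _)
        have := H.card_pos hκ hN j
        have := debiasVar_nonneg (e := e j) (H.mem_unit ht₀ j)
        gcongr
        exacts [le_debiasVar hl0 (he j) hl hh ht₀ (H.mem j), H.card_le j]

lemma abs_blockVar_sub_le (H : IsBalanced N κ t₀ S c τ T) (hκ : 0 < κ) (hN : 0 < N) {y : J → ℝ}
    {ρ : ℝ} (hρ : 0 ≤ ρ)
    (hy : ∀ j, c j ≠ 0 → |debiasVar (e j) (y j) - debiasVar (e j) (τ j)| ≤ ρ) :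
    |blockVar S c e y - blockVar S c e τ| ≤ Fintype.card J * (ρ / (κ * N ^ 2)) := by
  rw [blockVar, blockVar, ← Finset.sum_sub_distrib]
  refine (Finset.abs_sum_le_sum_abs _ _).trans ?_
  rw [← nsmul_eq_mul, ← Finset.card_univ, ← Finset.sum_const]
  refine Finset.sum_le_sum fun j _ => ?_
  have hc := H.card_pos hκ hN j
  by_cases hj : c j = 0
  · rw [hj]
    simp
    positivity
  · rw [← mul_sub, ← sub_div, abs_mul, abs_div, abs_of_pos hc, abs_of_nonneg (sq_nonneg (c j))]
    calc _ ≤ 1 * (ρ / (κ * N ^ 2)) := by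
          gcongr
          exacts [H.sq_le j, hy j hj, H.le_card j]
      _ = _ := one_mul _

lemma abs_remainder_le (H : IsBalanced N κ t₀ S c τ T) (ht₀ : 0 < t₀)
    (hl0 : 0 < l) (hl : l ≤ 1) (hh : 1 ≤ h) (he : ∀ j, e j ∈ Set.Icc l h) {y : J → ℝ}
    (hy01 : ∀ j, y j ∈ Set.Icc (0 : ℝ) 1) {r : ℝ} (hy : ∀ j, c j ≠ 0 → |y j - τ j| ≤ r) :
    |∑ j, c j * (debias (e j) (y j) - debias (e j) (τ j))
      - ∑ j, c j * debiasDeriv (e j) (τ j) * (y j - τ j)|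
      ≤ Fintype.card J * (h * (1 + h) / l ^ 3 * r ^ 2) := by
  rw [← Finset.sum_sub_distrib]
  refine (Finset.abs_sum_le_sum_abs _ _).trans ?_
  rw [← nsmul_eq_mul, ← Finset.card_univ, ← Finset.sum_const]
  refine Finset.sum_le_sum fun j _ => ?_
  have h0 : 0 ≤ h := by linarith
  by_cases hj : c j = 0
  · rw [hj]
    simp
    positivity
  · rw [mul_assoc, ← mul_sub, abs_mul]
    calc _ ≤ 1 * (h * (1 + h) / l ^ 3 * (y j - τ j) ^ 2) := by
          gcongr
          exacts [H.abs_le j, abs_debias_sub_le hl0 (he j) hl hh (hy01 j) (H.mem_unit ht₀ j)]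
      _ ≤ h * (1 + h) / l ^ 3 * r ^ 2 := by
          rw [one_mul, ← sq_abs (y j - τ j)]
          gcongr
          exact hy j hj

lemma abs_scoreWeight_le (H : IsBalanced N κ t₀ S c τ T) (hκ : 0 < κ) (hN : 0 < N) (ht₀ : 0 < t₀)
    (hl0 : 0 < l) (hl : l ≤ 1) (hh : 1 ≤ h) (he : ∀ j, e j ∈ Set.Icc l h) (p : ι) :
    |scoreWeight S c e τ p| ≤ Fintype.card J * (h / l ^ 2 / (κ * N ^ 2)) := by
  rw [scoreWeight]
  refine (Finset.abs_sum_le_sum_abs _ _).trans ?_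
  rw [← nsmul_eq_mul, ← Finset.card_univ, ← Finset.sum_const]
  refine Finset.sum_le_sum fun j _ => ?_
  have h0 : 0 ≤ h := by linarith
  have hc := H.card_pos hκ hN j
  refine (norm_indicator_le_norm_self (fun _ => c j * debiasDeriv (e j) (τ j) / ((S j).card : ℝ))
    p).trans ?_
  rw [Real.norm_eq_abs, abs_div, abs_mul, abs_of_pos hc]
  calc _ ≤ 1 * (h / l ^ 2) / (κ * N ^ 2) := by
        gcongr
        exacts [H.abs_le j, abs_debiasDeriv_le hl0 (he j) hl hh (H.mem_unit ht₀ j), H.le_card j]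
    _ = _ := by rw [one_mul]

variable [Fintype ι]

lemma sum_scoreWeight_mul (H : IsBalanced N κ t₀ S c τ T) (hκ : 0 < κ) (hN : 0 < N) (x : ι → ℝ) :
    ∑ p, scoreWeight S c e τ p * (x p - T p)
      = ∑ j, c j * debiasDeriv (e j) (τ j) * (blockMean (S j) x - τ j) := by
  classical
  simp_rw [scoreWeight, Finset.sum_mul]
  rw [Finset.sum_comm]
  refine Finset.sum_congr rfl fun j _ => ?_
  have hc := H.card_pos hκ hN j
  have e1 : ∀ p, (S j : Set ι).indicator
      (fun _ => c j * debiasDeriv (e j) (τ j) / ((S j).card : ℝ)) p * (x p - T p)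
      = if p ∈ S j then c j * debiasDeriv (e j) (τ j) / ((S j).card : ℝ) * (x p - T p) else 0 := by
    intro p
    simp [Set.indicator, ite_mul]
  simp_rw [e1]
  rw [Finset.sum_ite_mem, Finset.univ_inter, ← Finset.mul_sum]
  by_cases hj : c j = 0
  · simp [hj]
  · rw [Finset.sum_sub_distrib, Finset.sum_congr rfl (H.mean j hj), blockMean]
    simp only [Finset.sum_const, nsmul_eq_mul]
    field_simp

/-- The left side is the variance of the linear part. Disjointness of the blocks removes the cross
terms in the squared weight, so it is exactly the function whose plug-in value is the variance
estimator. -/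
lemma sum_scoreWeight_sq_mul (H : IsBalanced N κ t₀ S c τ T) (hκ : 0 < κ) (hN : 0 < N) :
    ∑ p, scoreWeight S c e τ p ^ 2 * (T p * (1 - T p)) = blockVar S c e τ := by
  classical
  have hsq : ∀ p, scoreWeight S c e τ p ^ 2 = ∑ j, if p ∈ S j then
      (c j * debiasDeriv (e j) (τ j) / ((S j).card : ℝ)) ^ 2 else 0 := by
    intro p
    by_cases hp : ∃ j, p ∈ S j
    · obtain ⟨j, hj⟩ := hp
      have hne : ∀ i, i ≠ j → p ∉ S i := fun i hi hpi =>
        Finset.disjoint_left.1 (H.disjoint i j hi) hpi hj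
      rw [scoreWeight, Finset.sum_eq_single j, Finset.sum_eq_single j]
      · simp [hj]
      · intro i _ hi; simp [hne i hi]
      · simp
      · intro i _ hi; simp [hne i hi]
      · simp
    · push Not at hp
      simp [scoreWeight, hp]
  simp_rw [hsq, Finset.sum_mul]
  rw [Finset.sum_comm, blockVar]
  refine Finset.sum_congr rfl fun j _ => ?_
  have hc := H.card_pos hκ hN j
  simp_rw [ite_mul, zero_mul]
  rw [Finset.sum_ite_mem, Finset.univ_inter, ← Finset.mul_sum]
  by_cases hj : c j = 0
  · simp [hj]
  · rw [Finset.sum_congr rfl (fun p hp => by rw [H.mean j hj p hp] :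
      ∀ p ∈ S j, T p * (1 - T p) = τ j * (1 - τ j)), debiasVar]
    simp only [Finset.sum_const, nsmul_eq_mul]
    field_simp

end IsBalanced

lemma exists_bounds_of_pos {J : Type*} [Fintype J] {e : J → ℝ} (he : ∀ j, 0 < e j) :
    ∃ l h : ℝ, 0 < l ∧ l ≤ 1 ∧ 1 ≤ h ∧ ∀ j, e j ∈ Set.Icc l h := by
  have h1 : 0 ≤ ∑ j, e j := Finset.sum_nonneg fun j _ => (he j).le
  have h2 : 0 ≤ ∑ j, (e j)⁻¹ := Finset.sum_nonneg fun j _ => (inv_pos.2 (he j)).le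
  refine ⟨(1 + ∑ j, (e j)⁻¹)⁻¹, 1 + ∑ j, e j, by positivity, inv_le_one_of_one_le₀ (by linarith),
    by linarith, fun j => ⟨?_, ?_⟩⟩
  · rw [inv_le_comm₀ (by positivity) (he j)]
    have := Finset.single_le_sum (f := fun j => (e j)⁻¹) (fun i _ => (inv_pos.2 (he i)).le)
      (Finset.mem_univ j)
    linarith
  · have := Finset.single_le_sum (f := e) (fun i _ => (he i).le) (Finset.mem_univ j)
    linarith

/-! ### Asymptotic coverage for balanced blocks -/

section Coverage

variable {J : Type*} [Fintype J] {Ω : ℕ → Type*} [∀ n, MeasurableSpace (Ω n)]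
  {Q : ∀ n, Measure (Ω n)} [∀ n, IsProbabilityMeasure (Q n)] {ι : ℕ → Type*}
  {X : ∀ n, ι n → Ω n → ℝ} {T : ∀ n, ι n → ℝ}
  {S : ∀ n, J → Finset (ι n)} {c τ : ℕ → J → ℝ} {e : J → ℝ} {κ t₀ : ℝ}

/-- With probability tending to one, all block means are within `ε / √n` of their expectations. -/
lemma tendsto_measureReal_compl_good [∀ n, Finite (ι n)]
    (hX : ∀ n, IsIndepZeroOne (Q n) (X n) (T n))
    (hκ : 0 < κ) (hbal : ∀ᶠ n : ℕ in atTop, IsBalanced (n : ℝ) κ t₀ (S n) (c n) (τ n) (T n))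
    {ε : ℝ} (hε : 0 < ε) :
    Tendsto (fun n : ℕ => (Q n).real {ω | (∀ p, X n p ω = 0 ∨ X n p ω = 1) ∧
      ∀ j, c n j ≠ 0 → |blockMean (S n j) (fun p => X n p ω) - τ n j| ≤ ε / √n}ᶜ)
      atTop (𝓝 0) := by
  have hlim : Tendsto (fun n : ℕ => Fintype.card J * (1 / (κ * ε ^ 2) * (n : ℝ)⁻¹)) atTop (𝓝 0) := by
    have := (tendsto_inv_atTop_nhds_zero_nat (𝕜 := ℝ)).const_mul (1 / (κ * ε ^ 2))
    simpa using this.const_mul (Fintype.card J : ℝ)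
  refine squeeze_zero' (Eventually.of_forall fun _ => measureReal_nonneg) ?_ hlim
  filter_upwards [hbal, eventually_gt_atTop 0] with n H hn
  have hN : (0 : ℝ) < n := by exact_mod_cast hn
  have hr : 0 < ε / √(n : ℝ) := div_pos hε (Real.sqrt_pos.2 hN)
  let Z : Set (Ω n) := {ω | ∀ p, X n p ω = 0 ∨ X n p ω = 1}ᶜ
  let B : J → Set (Ω n) := fun j =>
    {ω | c n j ≠ 0 ∧ ε / √(n : ℝ) < |blockMean (S n j) (fun p => X n p ω) - τ n j|}
  have hZ : (Q n).real Z = 0 := by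
    rw [measureReal_eq_zero_iff]
    exact ae_iff.1 (ae_all_iff.2 (hX n).zero_or_one)
  have hB : ∀ j, (Q n).real (B j) ≤ 1 / (κ * ε ^ 2) * (n : ℝ)⁻¹ := by
    intro j
    by_cases hj : c n j = 0
    · have : B j = ∅ := by
        ext ω
        simp [B, hj]
      rw [this, measureReal_empty]
      positivity
    · have hS : (S n j).Nonempty := Finset.card_pos.1 (by exact_mod_cast H.card_pos hκ hN j)
      have h1 := (hX n).measureReal_lt_abs_sub_le hS (H.mean j hj) hr
      -- A block has at least `κ * n ^ 2` dyads and the squared radius is `ε ^ 2 / n`, so Chebyshev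
      -- leaves a bound of order `1 / n`.
      calc (Q n).real (B j) ≤ 1 / ((S n j).card * (ε / √(n : ℝ)) ^ 2) :=
            (measureReal_mono fun ω hω => hω.2).trans h1
        _ ≤ 1 / (κ * (n : ℝ) ^ 2 * (ε / √(n : ℝ)) ^ 2) := by
            gcongr
            exact H.le_card j
        _ = _ := by
            rw [div_pow, Real.sq_sqrt hN.le]
            field_simp
  calc _ ≤ (Q n).real (Z ∪ ⋃ j, B j) := by
        refine measureReal_mono fun ω hω => ?_
        by_contra hcon
        simp only [Set.mem_union, Set.mem_iUnion, not_or, not_exists] at hcon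
        refine hω ⟨not_not.1 hcon.1, fun j hj => not_lt.1 fun hlt => hcon.2 j ⟨hj, hlt⟩⟩
    _ ≤ (Q n).real Z + ∑ j, (Q n).real (B j) :=
        (measureReal_union_le _ _).trans (add_le_add le_rfl (measureReal_iUnion_fintype_le _))
    _ ≤ 0 + ∑ _ : J, 1 / (κ * ε ^ 2) * (n : ℝ)⁻¹ :=
        add_le_add hZ.le (Finset.sum_le_sum fun j _ => hB j)
    _ = _ := by simp

variable [∀ n, Fintype (ι n)]

/-- Asymptotic normality of the linear part of the estimation error. -/
lemma tendsto_measureReal_abs_score_le (hX : ∀ n, IsIndepZeroOne (Q n) (X n) (T n))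
    (hκ : 0 < κ) (ht₀ : 0 < t₀) (he : ∀ j, 0 < e j)
    (hbal : ∀ᶠ n : ℕ in atTop, IsBalanced (n : ℝ) κ t₀ (S n) (c n) (τ n) (T n)) (x : ℝ) :
    Tendsto (fun n => (Q n).real
      {ω | |(∑ p, scoreWeight (S n) (c n) e (τ n) p * (X n p ω - T n p))
        / √(blockVar (S n) (c n) e (τ n))| ≤ x})
      atTop (𝓝 ((gaussianReal 0 1).real (Set.Icc (-x) x))) := by
  obtain ⟨l, h, hl0, hl, hh, hlh⟩ := exists_bounds_of_pos he
  have hh0 : 0 < h := by linarith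
  set s : ℕ → ℝ := fun n => √(blockVar (S n) (c n) e (τ n)) with hs
  set V0 := κ * ((l / h ^ 2) ^ 2 * (t₀ * t₀)) with hV0
  have hV0pos : 0 < V0 := by positivity
  let Y : ∀ n, ι n → Ω n → ℝ := fun n p ω =>
    scoreWeight (S n) (c n) e (τ n) p / s n * (X n p ω - T n p)
  have hsum : ∀ n ω, (∑ p, scoreWeight (S n) (c n) e (τ n) p * (X n p ω - T n p)) / s n
      = ∑ p, Y n p ω := fun n ω => by
    rw [Finset.sum_div]
    exact Finset.sum_congr rfl fun p _ => by simp only [Y]; ring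
  have hset : ∀ n, {ω | |(∑ p, scoreWeight (S n) (c n) e (τ n) p * (X n p ω - T n p))
      / √(blockVar (S n) (c n) e (τ n))| ≤ x} = {ω | |∑ p, Y n p ω| ≤ x} := fun n =>
    Set.ext fun ω => by rw [Set.mem_ofPred_eq, Set.mem_ofPred_eq, ← hsum]
  simp_rw [hset]
  refine tendsto_measureReal_abs_sum_le Q Y
    (fun n p => (((hX n).measurable p).sub_const _).const_mul _)
    (fun n => (hX n).indep.comp
      (fun p x => scoreWeight (S n) (c n) e (τ n) p / s n * (x - T n p)) fun p => by fun_prop)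
    (fun n p => by
      simp only [Y]
      rw [integral_const_mul, (hX n).integral_sub_mean, mul_zero])
    -- Weights of order at most `n ^ (-2)` over a standard deviation of at least `√V0 / n`.
    (fun n => Fintype.card J * (h / l ^ 2 / κ) / √V0 * (n : ℝ)⁻¹) ?_ ?_ ?_ x
  · simpa using (tendsto_inv_atTop_nhds_zero_nat (𝕜 := ℝ)).const_mul
      (Fintype.card J * (h / l ^ 2 / κ) / √V0)
  · filter_upwards [hbal, eventually_gt_atTop 0] with n H hn p
    have hN : (0 : ℝ) < n := by exact_mod_cast hn
    have hsn : √V0 / n ≤ s n := by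
      have := Real.sqrt_le_sqrt (H.le_blockVar hκ hN ht₀ hl0 hl hh hlh)
      rwa [Real.sqrt_div hV0pos.le, Real.sqrt_sq hN.le] at this
    have hq : 0 < √V0 / n := div_pos (Real.sqrt_pos.2 hV0pos) hN
    filter_upwards [(hX n).zero_or_one p] with ω hω
    have h1 : |X n p ω - T n p| ≤ 1 := by
      have := (hX n).mean_mem p
      rw [abs_le]
      rcases hω with hω | hω <;> rw [hω] <;> constructor <;> linarith [this.1, this.2]
    simp only [Y]
    rw [abs_mul, abs_div, abs_of_pos (hq.trans_le hsn)]
    calc _ ≤ Fintype.card J * (h / l ^ 2 / (κ * (n : ℝ) ^ 2)) / (√V0 / n) * 1 := by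
          gcongr
          exact H.abs_scoreWeight_le hκ hN ht₀ hl0 hl hh hlh p
      _ = _ := by
          have := (Real.sqrt_pos.2 hV0pos).ne'
          field_simp
  · filter_upwards [hbal, eventually_gt_atTop 0] with n H hn
    have hN : (0 : ℝ) < n := by exact_mod_cast hn
    have hpos : 0 < blockVar (S n) (c n) e (τ n) :=
      lt_of_lt_of_le (by positivity) (H.le_blockVar hκ hN ht₀ hl0 hl hh hlh)
    have e1 : ∀ p, ∫ ω, Y n p ω ^ 2 ∂Q n
        = scoreWeight (S n) (c n) e (τ n) p ^ 2 * (T n p * (1 - T n p))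
          / blockVar (S n) (c n) e (τ n) := fun p => by
      simp only [Y, mul_pow]
      rw [integral_const_mul, (hX n).integral_sub_mean_sq, div_pow, hs, Real.sq_sqrt hpos.le]
      ring
    simp_rw [e1]
    rw [← Finset.sum_div, H.sum_scoreWeight_sq_mul hκ hN, div_self hpos.ne']

/-- Asymptotic coverage of the interval that the delta method gives for a weighted sum of debiased
block means. -/
theorem tendsto_measureReal_coverage (hX : ∀ n, IsIndepZeroOne (Q n) (X n) (T n))
    (hκ : 0 < κ) (ht₀ : 0 < t₀) (he : ∀ j, 0 < e j)
    (hbal : ∀ᶠ n : ℕ in atTop, IsBalanced (n : ℝ) κ t₀ (S n) (c n) (τ n) (T n))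
    {φ : ℝ} (hφ : 0 ≤ φ) :
    Tendsto (fun n => (Q n).real {ω |
      |∑ j, c n j * (debias (e j) (blockMean (S n j) fun p => X n p ω) - debias (e j) (τ n j))| ≤
        φ * √(blockVar (S n) (c n) e fun j => blockMean (S n j) fun p => X n p ω)})
      atTop (𝓝 ((gaussianReal 0 1).real (Set.Icc (-φ) φ))) := by
  obtain ⟨l, h, hl0, hl, hh, hlh⟩ := exists_bounds_of_pos he
  have hh0 : 0 < h := by linarith
  set V0 := κ * ((l / h ^ 2) ^ 2 * (t₀ * t₀)) with hV0
  have hV0pos : 0 < V0 := by positivity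
  have hV0s : 0 < √V0 := Real.sqrt_pos.2 hV0pos
  refine tendsto_measureReal_of_sandwich Q _ continuous_gaussianReal_Icc
    (tendsto_measureReal_abs_score_le hX hκ ht₀ he hbal) _ fun δ hδ => ?_
  set k : ℝ := (Fintype.card J : ℝ) with hk
  have hk0 : 0 ≤ k := Nat.cast_nonneg _
  set C : ℝ := h * (1 + h) / l ^ 3 with hC
  have hC0 : 0 < C := by positivity
  -- Half of `δ` pays for the standard deviation, through `φ * r₁ ≤ δ / 2`, and half for the Taylor
  -- remainder. The tolerance `ρ` makes the relative variance error at most `r₁`.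
  set r₁ : ℝ := δ / (2 * (φ + 1)) with hr₁
  set ρ : ℝ := V0 * κ * r₁ / (k + 1) with hρ
  have hr₁pos : 0 < r₁ := by positivity
  have hρpos : 0 < ρ := by positivity
  obtain ⟨η, hη, hD⟩ := exists_abs_debiasVar_sub_le hl0 hl hh hρpos
  -- The bound 1 gives `ε ^ 2 ≤ ε`, and the last entry then gives `k * C * ε ^ 2 ≤ δ / 2 * √V0`; the
  -- added 1 keeps the denominator positive when `k = 0`.
  set ε : ℝ := min η (min 1 (δ * √V0 / (2 * (k * C + 1)))) with hε
  have hεpos : 0 < ε := by positivity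
  have hεη : ε ≤ η := min_le_left _ _
  have hε1 : ε ≤ 1 := (min_le_right _ _).trans (min_le_left _ _)
  have hε2 : ε ≤ δ * √V0 / (2 * (k * C + 1)) := (min_le_right _ _).trans (min_le_right _ _)
  refine ⟨_, tendsto_measureReal_compl_good hX hκ hbal hεpos, ?_⟩
  filter_upwards [hbal, eventually_ge_atTop 1] with n H hn ω hω
  obtain ⟨h01, hclose⟩ := hω
  have hN1 : (1 : ℝ) ≤ n := by exact_mod_cast hn
  have hN : (0 : ℝ) < n := by linarith
  have hsq1 : 1 ≤ √(n : ℝ) := Real.one_le_sqrt.2 hN1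
  set y : J → ℝ := fun j => blockMean (S n j) fun p => X n p ω with hy
  have hy01 : ∀ j, y j ∈ Set.Icc (0 : ℝ) 1 := fun j => blockMean_mem h01
  have hVle := H.le_blockVar hκ hN ht₀ hl0 hl hh hlh
  have hVpos : 0 < blockVar (S n) (c n) e (τ n) := lt_of_lt_of_le (by positivity) hVle
  have hspos : 0 < √(blockVar (S n) (c n) e (τ n)) := Real.sqrt_pos.2 hVpos
  have hsn : √V0 / n ≤ √(blockVar (S n) (c n) e (τ n)) := by
    have := Real.sqrt_le_sqrt hVle
    rwa [Real.sqrt_div hV0pos.le, Real.sqrt_sq hN.le] at this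
  have hVy : 0 ≤ blockVar (S n) (c n) e y := Finset.sum_nonneg fun j _ =>
    mul_nonneg (sq_nonneg _) (div_nonneg (debiasVar_nonneg (hy01 j)) (Nat.cast_nonneg _))
  have hdiff : |blockVar (S n) (c n) e y - blockVar (S n) (c n) e (τ n)|
      ≤ r₁ * blockVar (S n) (c n) e (τ n) := by
    refine (H.abs_blockVar_sub_le hκ hN hρpos.le fun j hj => ?_).trans ?_
    · refine hD _ (hlh j) _ (hy01 j) _ (H.mem_unit ht₀ j) ((hclose j hj).trans ?_)
      exact (div_le_self hεpos.le hsq1).trans hεη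
    · calc k * (ρ / (κ * (n : ℝ) ^ 2)) = k / (k + 1) * (r₁ * (V0 / (n : ℝ) ^ 2)) := by
            rw [hρ]; field_simp
        _ ≤ 1 * (r₁ * (V0 / (n : ℝ) ^ 2)) := by
            gcongr
            exact div_le_one_of_le₀ (by linarith) (by linarith)
        _ ≤ r₁ * blockVar (S n) (c n) e (τ n) := by
            rw [one_mul]
            gcongr
  have hrem := H.abs_remainder_le ht₀ hl0 hl hh hlh hy01 hclose
  rw [← H.sum_scoreWeight_mul hκ hN fun p => X n p ω] at hrem
  refine abs_le_iff_up_to (r₁ := r₁) (r₂ := δ / 2) hspos (hrem.trans ?_)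
    (abs_sqrt_sub_sqrt_le hVy hVpos hdiff) hφ ?_
  · rw [div_pow, Real.sq_sqrt hN.le]
    have h1 : k * C * ε ^ 2 ≤ δ / 2 * √V0 := by
      have h2 : ε ^ 2 ≤ ε := by nlinarith
      rw [le_div_iff₀ (by positivity)] at hε2
      have : k * C * ε ^ 2 ≤ k * C * ε := mul_le_mul_of_nonneg_left h2 (by positivity)
      nlinarith
    calc k * (C * (ε ^ 2 / n)) = k * C * ε ^ 2 / n := by ring
      _ ≤ δ / 2 * √V0 / n := by gcongr
      _ = δ / 2 * (√V0 / n) := by ring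
      _ ≤ _ := by gcongr
  · have : φ * r₁ ≤ δ / 2 := by
      rw [hr₁, ← mul_div_assoc, div_le_div_iff₀ (by positivity) (by positivity)]
      nlinarith
    linarith

end Coverage

/-! ### The estimators and the target as sums over cells -/

lemma debias_condMean {γ m : ℝ} (s : Fin 2) (hm : m ∈ Set.Ioo (0 : ℝ) 1) :
    debias (Real.exp (shift γ s)) (condMean γ s m) = m := by
  have he := Real.exp_pos (shift γ s)
  have h0 := hm.1
  have h1 : 0 < 1 - m := by linarith [hm.2]
  have hd : 0 < m * Real.exp (shift γ s) + (1 - m) := by positivity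
  have e1 : condMean γ s m + (1 - condMean γ s m) * Real.exp (shift γ s)
      = Real.exp (shift γ s) / (m * Real.exp (shift γ s) + (1 - m)) := by
    rw [condMean]; field_simp; ring
  rw [debias, e1, condMean]
  field_simp

/-- The normalising denominator is a convex combination of 1 and the odds factor, hence at most `h`.
The margin does not depend on `n`, as the variance lower bound requires. -/
lemma condMean_mem {γ m l h N₀ N₁ : ℝ} {s : Fin 2} (hN₀ : 0 < N₀) (hN₁ : N₁ < 1)
    (hm : m ∈ Set.Icc N₀ N₁) (hl0 : 0 < l) (hh : 1 ≤ h)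
    (he : Real.exp (shift γ s) ∈ Set.Icc l h) :
    condMean γ s m ∈ Set.Icc (min (N₀ * l / h) ((1 - N₁) / h))
      (1 - min (N₀ * l / h) ((1 - N₁) / h)) := by
  set e := Real.exp (shift γ s) with hee
  obtain ⟨h1, h2⟩ := hm
  obtain ⟨h3, h4⟩ := he
  have hd : 0 < m * e + (1 - m) := by nlinarith
  have hd' : m * e + (1 - m) ≤ h := by nlinarith
  have hh0 : 0 < h := by linarith
  have e1 : 1 - condMean γ s m = (1 - m) / (m * e + (1 - m)) := by
    rw [condMean, ← hee]; field_simp; ring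
  constructor
  · refine (min_le_left _ _).trans ?_
    rw [condMean, ← hee]
    have : 0 ≤ m * e := by nlinarith
    have : 0 ≤ m := by linarith
    gcongr
  · have : min (N₀ * l / h) ((1 - N₁) / h) ≤ 1 - condMean γ s m := by
      refine (min_le_right _ _).trans ?_
      rw [e1]
      have : 0 ≤ 1 - m := by linarith
      gcongr
    linarith

section Blocks

variable {n K : ℕ} {Z : Matrix (Fin n) (Fin K) ℝ} {a : Matrix (Fin n) (Fin n) ℝ}

lemma sum_block (hZ : IsMembership Z) (k l : Fin K) (x : Fin n × Fin n → ℝ) :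
    ∑ p ∈ block Z k l, x p = ∑ i, ∑ j, Z i k * x (i, j) * Z j l := by
  classical
  rw [block, Finset.sum_filter, ← Finset.univ_product_univ, Finset.sum_product]
  refine Finset.sum_congr rfl fun i _ => Finset.sum_congr rfl fun j _ => ?_
  rcases hZ.zero_or_one i k with h | h <;> rcases hZ.zero_or_one j l with h' | h' <;>
    simp [h, h']

lemma card_block (hZ : IsMembership Z) (k l : Fin K) :
    ((block Z k l).card : ℝ) = (∑ i, Z i k) * ∑ j, Z j l := by
  have := sum_block hZ k l fun _ => 1
  rw [Finset.sum_const, nsmul_eq_mul, mul_one] at this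
  rw [this, Finset.sum_mul_sum]
  simp

lemma transpose_mul_self_eq (hZ : IsMembership Z) :
    Z.transpose * Z = Matrix.diagonal fun k => ∑ i, Z i k := by
  ext k l
  rw [Matrix.mul_apply]
  simp only [Matrix.transpose_apply]
  by_cases hkl : k = l
  · subst hkl
    rw [Matrix.diagonal_apply_eq]
    exact Finset.sum_congr rfl fun i _ => by rcases hZ.zero_or_one i k with h | h <;> simp [h]
  · rw [Matrix.diagonal_apply_ne _ hkl]
    refine Finset.sum_eq_zero fun i _ => ?_
    rcases hZ.zero_or_one i k with h | h
    · simp [h]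
    · rcases hZ.zero_or_one i l with h' | h'
      · simp [h']
      · exact absurd (hZ.unique i k l h h') hkl

/-- The target is the weighted sum of the block means of the expected network. -/
lemma target_eq (hZ : IsMembership Z) (hne : ∀ k l, (block Z k l).Nonempty)
    (E : Matrix (Fin n) (Fin n) ℝ) (u : EuclideanSpace ℝ (Fin K × Fin K)) :
    target E Z u = ∑ q, u q * blockMean (block Z q.2 q.1) fun p => E p.1 p.2 := by
  -- The Gram matrix is diagonal with the community sizes, and an empty community would make its
  -- diagonal block empty.
  have hpos : ∀ k, (∑ i, Z i k) ≠ 0 := fun k h0 => by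
    have h1 := card_block hZ k k
    rw [h0, zero_mul, Nat.cast_eq_zero, Finset.card_eq_zero] at h1
    exact (hne k k).ne_empty h1
  have hinv : (Z.transpose * Z)⁻¹ = Matrix.diagonal fun k => (∑ i, Z i k)⁻¹ := by
    rw [transpose_mul_self_eq hZ]
    refine Matrix.inv_eq_right_inv ?_
    rw [Matrix.diagonal_mul_diagonal]
    simp [hpos]
  rw [target, dotProduct, hinv]
  refine Finset.sum_congr rfl fun q _ => ?_
  congr 1
  rw [Matrix.vec, Matrix.mul_diagonal, Matrix.mul_assoc, Matrix.mul_assoc, Matrix.diagonal_mul,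
    blockMean, sum_block hZ, card_block hZ, Matrix.mul_apply]
  have e1 : ∑ i, Z.transpose q.2 i * (E * Z) i q.1 = ∑ i, ∑ j, Z i q.2 * E i j * Z j q.1 :=
    Finset.sum_congr rfl fun i _ => by
      rw [Matrix.mul_apply, Finset.mul_sum]
      exact Finset.sum_congr rfl fun j _ => by rw [Matrix.transpose_apply, mul_assoc]
  rw [e1, div_eq_mul_inv, mul_inv]
  ring

lemma card_subBlock_add (ha : ∀ p : Fin n × Fin n, ∃ s : Fin 2, a p.1 p.2 = ((s : ℕ) : ℝ))
    (k l : Fin K) :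
    ((subBlock Z a 0 k l).card : ℝ) + (subBlock Z a 1 k l).card = (block Z k l).card := by
  classical
  rw [← Nat.cast_add, Nat.cast_inj, subBlock, subBlock,
    ← Finset.card_filter_add_card_filter_not (s := block Z k l) fun p => a p.1 p.2 = ((0 : ℕ) : ℝ)]
  congr 2
  refine Finset.filter_congr fun p _ => ?_
  obtain ⟨s, hs⟩ := ha p
  fin_cases s <;> simp [hs]

lemma sum_blockFraction (ha : ∀ p : Fin n × Fin n, ∃ s : Fin 2, a p.1 p.2 = ((s : ℕ) : ℝ))
    {k l : Fin K} (hne : (block Z k l).Nonempty) :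
    blockFraction Z a 0 k l + blockFraction Z a 1 k l = 1 := by
  rw [blockFraction, blockFraction, ← add_div, card_subBlock_add ha]
  exact div_self (by exact_mod_cast hne.card_pos.ne')

lemma blockFraction_nonneg (s : Fin 2) (k l : Fin K) : 0 ≤ blockFraction Z a s k l :=
  div_nonneg (Nat.cast_nonneg _) (Nat.cast_nonneg _)

lemma blockFraction_le_one (s : Fin 2) (k l : Fin K) : blockFraction Z a s k l ≤ 1 := by
  classical
  refine div_le_one_of_le₀ ?_ (Nat.cast_nonneg _)
  exact_mod_cast Finset.card_le_card (Finset.filter_subset _ _)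

/-- The sub-blocks, indexed by the entries of the weight vector and by the train value. -/
noncomputable def cell (Z : Matrix (Fin n) (Fin K) ℝ) (a : Matrix (Fin n) (Fin n) ℝ)
    (j : (Fin K × Fin K) × Fin 2) : Finset (Fin n × Fin n) :=
  subBlock Z a j.2 j.1.2 j.1.1

noncomputable def cellWeight (Z : Matrix (Fin n) (Fin K) ℝ) (a : Matrix (Fin n) (Fin n) ℝ)
    (u : EuclideanSpace ℝ (Fin K × Fin K)) (j : (Fin K × Fin K) × Fin 2) : ℝ :=
  u j.1 * blockFraction Z a j.2 j.1.2 j.1.1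

/-- Averaging `M` first makes the debiased value equal to the target's block mean even where `M`
varies; on blocks of nonzero weight it is the common conditional mean of the edges. -/
noncomputable def cellMean (γ : ℝ) (Z : Matrix (Fin n) (Fin K) ℝ) (M : Matrix (Fin n) (Fin n) ℝ)
    (j : (Fin K × Fin K) × Fin 2) : ℝ :=
  condMean γ j.2 (blockMean (block Z j.1.2 j.1.1) fun p => M p.1 p.2)

noncomputable def cellOdds (K : ℕ) (γ : ℝ) (j : (Fin K × Fin K) × Fin 2) : ℝ :=
  Real.exp (shift γ j.2)

lemma xiHat_sub_target {γ : ℝ} (te M : Matrix (Fin n) (Fin n) ℝ) (hZ : IsMembership Z)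
    (hne : ∀ k l, (block Z k l).Nonempty)
    (ha : ∀ p : Fin n × Fin n, ∃ s : Fin 2, a p.1 p.2 = ((s : ℕ) : ℝ))
    (hM : ∀ k l, (blockMean (block Z k l) fun p => M p.1 p.2) ∈ Set.Ioo (0 : ℝ) 1)
    (u : EuclideanSpace ℝ (Fin K × Fin K)) :
    xiHat γ Z a te u - target M Z u = ∑ j, cellWeight Z a u j *
      (debias (cellOdds K γ j) (blockMean (cell Z a j) fun p => te p.1 p.2)
        - debias (cellOdds K γ j) (cellMean γ Z M j)) := by
  rw [target_eq hZ hne, xiHat, dotProduct, ← Finset.sum_sub_distrib, Fintype.sum_prod_type (α₁ := Fin K × Fin K) (α₂ := Fin 2)]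
  refine Finset.sum_congr rfl fun q _ => ?_
  have hf := sum_blockFraction (Z := Z) ha (hne q.2 q.1)
  simp only [cellWeight, cellOdds, cellMean, cell, debias_condMean _ (hM q.2 q.1),
    Fin.sum_univ_two, Matrix.vec, PhiHat, Matrix.of_apply]
  have hV : ∀ s, Vhat γ Z a te s q.2 q.1 = debias (Real.exp (shift γ s))
      (blockMean (subBlock Z a s q.2 q.1) fun p => te p.1 p.2) := fun s => rfl
  rw [hV, hV]
  -- Both cells of a block debias to the same mean, and their fractions sum to one.
  linear_combination (u q * blockMean (block Z q.2 q.1) fun p => M p.1 p.2) * hf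

lemma sigmaHat_eq {γ : ℝ} (te : Matrix (Fin n) (Fin n) ℝ)
    (u : EuclideanSpace ℝ (Fin K × Fin K)) :
    sigmaHat γ Z a te u = √(blockVar (cell Z a) (cellWeight Z a u) (cellOdds K γ)
      fun j => blockMean (cell Z a j) fun p => te p.1 p.2) := by
  rw [sigmaHat, blockVar, dotProduct, Fintype.sum_prod_type (α₁ := Fin K × Fin K) (α₂ := Fin 2)]
  congr 1
  refine Finset.sum_congr rfl fun q _ => ?_
  rw [Matrix.mulVec_diagonal]
  have hD : ∀ s, subDeltaHat γ Z a te s q.2 q.1 = debiasVar (Real.exp (shift γ s))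
      (blockMean (subBlock Z a s q.2 q.1) fun p => te p.1 p.2)
      / ((subBlock Z a s q.2 q.1).card : ℝ) := fun s => by
    have hB : Bhat Z a te s q.2 q.1
      = blockMean (subBlock Z a s q.2 q.1) fun p => te p.1 p.2 := rfl
    rw [subDeltaHat, hB, debiasVar, debiasDeriv, two_mul, Real.exp_add,
      add_comm (_ * Real.exp _)]
    -- An identity in the inverses themselves, hence valid also when a cell is empty.
    simp only [div_eq_mul_inv, mul_inv, mul_pow, inv_pow]
    ring
  simp only [cellWeight, cellOdds, cell, Fin.sum_univ_two, Matrix.vec, DeltaHat, Matrix.of_apply,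
    hD]
  ring

lemma block_nonempty_of_subBlock {s : Fin 2} {k l : Fin K} (h : (subBlock Z a s k l).Nonempty) :
    (block Z k l).Nonempty := by
  classical
  exact h.mono (Finset.filter_subset _ _)

lemma blockMean_mem_Icc {ι : Type*} {S : Finset ι} (hS : S.Nonempty) {x : ι → ℝ} {b₀ b₁ : ℝ}
    (hx : ∀ p ∈ S, x p ∈ Set.Icc b₀ b₁) : blockMean S x ∈ Set.Icc b₀ b₁ := by
  have hc : (0 : ℝ) < S.card := by exact_mod_cast hS.card_pos
  rw [blockMean, Set.mem_Icc, le_div_iff₀ hc, div_le_iff₀ hc]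
  constructor
  · calc b₀ * S.card = ∑ _p ∈ S, b₀ := by simp [mul_comm]
      _ ≤ _ := Finset.sum_le_sum fun p hp => (hx p hp).1
  · calc _ ≤ ∑ _p ∈ S, b₁ := Finset.sum_le_sum fun p hp => (hx p hp).2
      _ = b₁ * S.card := by simp [mul_comm]

lemma blockMean_eq_of_const {ι : Type*} {S : Finset ι} {x : ι → ℝ} {p : ι} (hp : p ∈ S)
    (hx : ∀ q ∈ S, x q = x p) : blockMean S x = x p := by
  have hc : (S.card : ℝ) ≠ 0 := by
    exact_mod_cast (Finset.card_pos.2 ⟨p, hp⟩).ne'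
  rw [blockMean, Finset.sum_congr rfl hx, Finset.sum_const, nsmul_eq_mul]
  field_simp

lemma isBalanced_cell {γ κ N₀ N₁ l h : ℝ} (hN₀ : 0 < N₀) (hN₁ : N₁ < 1)
    {M : Matrix (Fin n) (Fin n) ℝ} (hM : ∀ i j, N₀ ≤ M i j ∧ M i j ≤ N₁)
    (hl0 : 0 < l) (hh : 1 ≤ h) (hlh : ∀ s, Real.exp (shift γ s) ∈ Set.Icc l h)
    (hZ : IsMembership Z) (hne : ∀ k l, (block Z k l).Nonempty)
    (ha : ∀ p : Fin n × Fin n, ∃ s : Fin 2, a p.1 p.2 = ((s : ℕ) : ℝ))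
    (hκ : κ ≤ 1 / 2) (hcard : ∀ j, κ * (n : ℝ) ^ 2 ≤ (cell Z a j).card)
    {u : EuclideanSpace ℝ (Fin K × Fin K)} (hu : ‖u‖ = 1)
    (hconst : ∀ k l, u (l, k) ≠ 0 → {m | ∃ p ∈ block Z k l, M p.1 p.2 = m}.Subsingleton)
    {T : Fin n × Fin n → ℝ} (hT : ∀ (p : Fin n × Fin n) (s : Fin 2), a p.1 p.2 = ((s : ℕ) : ℝ) →
      T p = condMean γ s (M p.1 p.2)) :
    IsBalanced (n : ℝ) κ (min (N₀ * l / h) ((1 - N₁) / h)) (cell Z a) (cellWeight Z a u)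
      (cellMean γ Z M) T := by
  classical
  have mem_cell : ∀ {p : Fin n × Fin n} {j}, p ∈ cell Z a j →
      (Z p.1 j.1.2 = 1 ∧ Z p.2 j.1.1 = 1) ∧ a p.1 p.2 = ((j.2 : ℕ) : ℝ) := by
    intro p j hp
    simpa [cell, subBlock, block] using hp
  have husq : ∑ q, u q ^ 2 = 1 := by
    have := EuclideanSpace.norm_sq_eq u
    rw [hu] at this
    simpa using this.symm
  constructor
  · intro i j hij
    rw [Finset.disjoint_left]
    intro p hi hj
    obtain ⟨⟨h1, h2⟩, h3⟩ := mem_cell hi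
    obtain ⟨⟨h4, h5⟩, h6⟩ := mem_cell hj
    refine hij (Prod.ext (Prod.ext (hZ.unique _ _ _ h2 h5) (hZ.unique _ _ _ h1 h4)) ?_)
    rw [h3] at h6
    exact Fin.ext (by exact_mod_cast h6)
  · intro j
    have := Finset.card_le_univ (cell Z a j)
    rw [Fintype.card_prod, Fintype.card_fin, ← sq] at this
    exact_mod_cast this
  · exact hcard
  · intro j
    have h1 : |u j.1| ≤ 1 := by
      rw [← hu]; exact PiLp.norm_apply_le u j.1
    rw [cellWeight, abs_mul, abs_of_nonneg (blockFraction_nonneg _ _ _)]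
    exact mul_le_one₀ h1 (blockFraction_nonneg _ _ _) (blockFraction_le_one _ _ _)
  · rw [Fintype.sum_prod_type (α₁ := Fin K × Fin K) (α₂ := Fin 2)]
    calc κ ≤ ∑ q, u q ^ 2 * (1 / 2) := by rw [← Finset.sum_mul, husq, one_mul]; exact hκ
      _ ≤ _ := by
        refine Finset.sum_le_sum fun q _ => ?_
        have hf := sum_blockFraction (Z := Z) ha (hne q.2 q.1)
        simp only [Fin.sum_univ_two, cellWeight, mul_pow]
        rw [← mul_add]
        refine mul_le_mul_of_nonneg_left ?_ (sq_nonneg _)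
        -- Two numbers with sum one have squares summing to at least `1 / 2`; hence the requirement
        -- `κ ≤ 1 / 2`.
        nlinarith [sq_nonneg (blockFraction Z a 0 q.2 q.1 - blockFraction Z a 1 q.2 q.1)]
  · intro j
    exact condMean_mem hN₀ hN₁ (blockMean_mem_Icc (hne _ _) fun p _ => hM p.1 p.2) hl0 hh (hlh _)
  · intro j hj p hp
    have huj : u j.1 ≠ 0 := fun h0 => hj (by rw [cellWeight, h0, zero_mul])
    have hpb : p ∈ block Z j.1.2 j.1.1 := Finset.filter_subset _ _ hp
    rw [hT p j.2 (mem_cell hp).2, cellMean, blockMean_eq_of_const hpb fun q hq =>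
      hconst j.1.2 j.1.1 huj ⟨q, hq, rfl⟩ ⟨p, hpb, rfl⟩]

end Blocks

lemma mem_interval_iff {n K : ℕ} {γ α t : ℝ} {Z : Matrix (Fin n) (Fin K) ℝ}
    {a te : Matrix (Fin n) (Fin n) ℝ} {u : EuclideanSpace ℝ (Fin K × Fin K)} :
    t ∈ interval γ α Z a te u ↔
      |xiHat γ Z a te u - t| ≤ normalQuantile (1 - α / 2) * sigmaHat γ Z a te u := by
  rw [interval, Set.mem_Icc, abs_le]
  constructor <;> rintro ⟨h1, h2⟩ <;> constructor <;> linarith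

/-- Given the train network and the detected communities, the edges are independent, with the means
of Bayes' rule. -/
lemma IsBernoulliModel.cond_train_detect {Ω : Type*} [MeasurableSpace Ω] {P : Measure Ω}
    [IsProbabilityMeasure P] {n K : ℕ} {M : Matrix (Fin n) (Fin n) ℝ} {γ : ℝ}
    {A W : Ω → Matrix (Fin n) (Fin n) ℝ} (h : IsBernoulliModel P M γ A W)
    (hγ : γ ∈ Set.Ioo (0 : ℝ) (1 / 2)) {E : Type*} [MeasurableSpace E] {aux : Ω → E}
    (haux : Measurable aux) (hind : IndepFun aux (fun ω x => entries A W x ω) P)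
    {detect : Matrix (Fin n) (Fin n) ℝ → E → Matrix (Fin n) (Fin K) ℝ}
    {a : Matrix (Fin n) (Fin n) ℝ} {z : Matrix (Fin n) (Fin K) ℝ}
    (hD : MeasurableSet {e | detect a e = z})
    (hne : P {ω | train (A ω) (W ω) = a ∧ detect (train (A ω) (W ω)) (aux ω) = z} ≠ 0) :
    let Q := cond P {ω | train (A ω) (W ω) = a ∧ detect (train (A ω) (W ω)) (aux ω) = z}
    IsIndepZeroOne Q (fun (p : Fin n × Fin n) ω => A ω p.1 p.2) (fun p => ∫ ω, A ω p.1 p.2 ∂Q) ∧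
    (∀ p : Fin n × Fin n, ∃ s : Fin 2, a p.1 p.2 = ((s : ℕ) : ℝ)) ∧
    (∀ (p : Fin n × Fin n) (s : Fin 2), a p.1 p.2 = ((s : ℕ) : ℝ) →
      ∫ ω, A ω p.1 p.2 ∂Q = condMean γ s (M p.1 p.2)) ∧
    ∀ᵐ ω ∂Q, train (A ω) (W ω) = a ∧ detect (train (A ω) (W ω)) (aux ω) = z := by
  have mA : ∀ p : Fin n × Fin n, Measurable fun ω => A ω p.1 p.2 := fun p =>
    h.measurable (Sum.inl p)
  have mW : ∀ p : Fin n × Fin n, Measurable fun ω => W ω p.1 p.2 := fun p =>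
    h.measurable (Sum.inr p)
  have hmD : MeasurableSet (aux ⁻¹' {e | detect a e = z}) := haux hD
  have hmT : MeasurableSet {ω | train (A ω) (W ω) = a} := by
    rw [setOf_train_eq]
    exact MeasurableSet.iInter fun p => (((mA p).mul ((mW p).const_sub 1)).add
      (((mA p).const_sub 1).mul (mW p))) (measurableSet_singleton _)
  have hev : {ω | train (A ω) (W ω) = a ∧ detect (train (A ω) (W ω)) (aux ω) = z}
      = aux ⁻¹' {e | detect a e = z} ∩ {ω | train (A ω) (W ω) = a} := by
    ext ω
    constructor
    · rintro ⟨h1, h2⟩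
      refine ⟨?_, h1⟩
      rw [h1] at h2
      exact h2
    · rintro ⟨h1, h2⟩
      have h2' : train (A ω) (W ω) = a := h2
      refine ⟨h2', ?_⟩
      rw [h2']
      exact h1
  have hmev := hmD.inter hmT
  rw [← hev] at hmev
  intro Q
  have hDne : P (aux ⁻¹' {e | detect a e = z}) ≠ 0 := fun h0 =>
    hne (by rw [hev]; exact measure_mono_null Set.inter_subset_left h0)
  -- Condition in two stages: first on the auxiliary randomness, which preserves the model, then on
  -- the train network.
  have hQ : Q = cond (cond P (aux ⁻¹' {e | detect a e = z})) {ω | train (A ω) (W ω) = a} := by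
    rw [cond_cond_eq_cond_inter hmD hmT, ← hev]
  have hP' : IsProbabilityMeasure (cond P (aux ⁻¹' {e | detect a e = z})) :=
    cond_isProbabilityMeasure hDne
  have hm' := h.cond_of_indepFun haux hind hD hDne
  obtain ⟨h1, h2, h3⟩ := hm'.cond_train hγ (a := a)
    (cond_pos_of_inter_ne_zero hmD (by rwa [← hev])).ne'
  rw [← hQ] at h1 h3
  refine ⟨⟨mA, h1, fun p => ?_, fun p => rfl⟩, h2, h3, ?_⟩
  · exact cond_absolutelyContinuous.ae_le (h.edge_law p.1 p.2).ae_eq_zero_or_one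
  · exact ae_cond_mem hmev

end NetworkFission

/-! ### The coverage theorem -/

theorem mainTheorem4
    {K : ℕ} {γ α N₀ N₁ : ℝ}
    (hγ : γ ∈ Set.Ioo (0 : ℝ) (1 / 2)) (hα : α ∈ Set.Ioo (0 : ℝ) 1)
    -- For every `n`, a probability space carrying the network `A n`, the toggles `W n`
    -- and the auxiliary randomness `aux n` of the community detection.
    {Ω : ℕ → Type*} [∀ n, MeasurableSpace (Ω n)]
    (P : ∀ n, Measure (Ω n)) [∀ n, IsProbabilityMeasure (P n)]
    (M : ∀ n, Matrix (Fin n) (Fin n) ℝ)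
    (hN₀ : 0 < N₀) (hN₁ : N₁ < 1) (hM : ∀ n i j, N₀ ≤ M n i j ∧ M n i j ≤ N₁)
    (A W : ∀ n, Ω n → Matrix (Fin n) (Fin n) ℝ)
    (hmodel : ∀ n, NetworkFission.IsBernoulliModel (P n) (M n) γ (A n) (W n))
    {E : ℕ → Type*} [∀ n, MeasurableSpace (E n)]
    (aux : ∀ n, Ω n → E n) (haux : ∀ n, Measurable (aux n))
    (haux_indep : ∀ n,
      IndepFun (aux n) (fun ω x => NetworkFission.entries (A n) (W n) x ω) (P n))
    -- Community detection, applied to the train network (and the auxiliary randomness).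
    (detect : ∀ n, Matrix (Fin n) (Fin n) ℝ → E n → Matrix (Fin n) (Fin K) ℝ)
    (hdetect_meas : ∀ n a z, MeasurableSet {e | detect n a e = z})
    (hdetect : ∀ n a e, NetworkFission.IsMembership (detect n a e))
    (Atr : ∀ n, Ω n → Matrix (Fin n) (Fin n) ℝ)
    (hAtr : ∀ n ω, Atr n ω = NetworkFission.train (A n ω) (W n ω))
    (Zhat : ∀ n, Ω n → Matrix (Fin n) (Fin K) ℝ)
    (hZhat : ∀ n ω, Zhat n ω = detect n (Atr n ω) (aux n ω))
    -- The weight vector may depend on the train network and on the estimated communities.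
    (u : ∀ n, Matrix (Fin n) (Fin n) ℝ → Matrix (Fin n) (Fin K) ℝ →
      EuclideanSpace ℝ (Fin K × Fin K))
    (hu : ∀ n a z, ‖u n a z‖ = 1)
    -- The sequences of realizations on which we condition.
    (a : ∀ n, Matrix (Fin n) (Fin n) ℝ) (z : ∀ n, Matrix (Fin n) (Fin K) ℝ)
    (hreal : ∀ n, P n {ω | Atr n ω = a n ∧ Zhat n ω = z n} ≠ 0)
    (hsize : ∀ (s : Fin 2) (k l : Fin K),
      (∀ᶠ n in atTop, (NetworkFission.subBlock (z n) (a n) s k l).Nonempty) ∧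
      (fun n => ((NetworkFission.subBlock (z n) (a n) s k l).card : ℝ)⁻¹)
        =O[atTop] (fun n : ℕ => ((n : ℝ) ^ 2)⁻¹))
    (hconst : ∃ N, ∀ n ≥ N, ∀ k l : Fin K, u n (a n) (z n) (l, k) ≠ 0 →
      {m | ∃ p ∈ NetworkFission.block (z n) k l, M n p.1 p.2 = m}.Subsingleton) :
    Tendsto
      (fun n => (cond (P n) {ω | Atr n ω = a n ∧ Zhat n ω = z n}).real
        {ω | NetworkFission.target (NetworkFission.expectation (P n) (A n)) (Zhat n ω)
              (u n (Atr n ω) (Zhat n ω)) ∈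
            NetworkFission.interval γ α (Zhat n ω) (Atr n ω) (A n ω)
              (u n (Atr n ω) (Zhat n ω))})
      atTop (𝓝 (1 - α)) := by
  obtain ⟨l, h, hl0, -, hh, hlh⟩ :=
    NetworkFission.exists_bounds_of_pos fun s : Fin 2 => Real.exp_pos (NetworkFission.shift γ s)
  choose hne hO using hsize
  have hb : ∀ j : (Fin K × Fin K) × Fin 2, ∃ C > 0, ∀ᶠ n : ℕ in atTop,
      (((NetworkFission.cell (z n) (a n) j).card : ℝ))⁻¹ ≤ C * ((n : ℝ) ^ 2)⁻¹ := fun j => by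
    obtain ⟨C, hC, hb⟩ := (hO j.2 j.1.2 j.1.1).exists_pos
    refine ⟨C, hC, hb.bound.mono fun n hn => ?_⟩
    rwa [Real.norm_of_nonneg (by positivity), Real.norm_of_nonneg (by positivity)] at hn
  choose C hC hb using hb
  -- The size condition reads `card ≥ n ^ 2 / C j`; a common lower bound of the finitely many `(C
  -- j)⁻¹` serves all cells.
  obtain ⟨κ₁, _, hκ₁, _, _, hκC⟩ := NetworkFission.exists_bounds_of_pos fun j => inv_pos.2 (hC j)
  set κ : ℝ := min κ₁ (1 / 2) with hκ
  have hκ0 : 0 < κ := by positivity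
  set t₀ : ℝ := min (N₀ * l / h) ((1 - N₁) / h) with ht₀
  have ht₀0 : 0 < t₀ := by
    have : 0 < h := by linarith
    have : 0 < 1 - N₁ := by linarith
    positivity
  have hAtr' : Atr = fun n ω => NetworkFission.train (A n ω) (W n ω) := by
    funext n ω; exact hAtr n ω
  have hZhat' : Zhat = fun n ω => detect n (NetworkFission.train (A n ω) (W n ω)) (aux n ω) := by
    funext n ω; rw [hZhat, hAtr]
  have hcond := fun n => (hmodel n).cond_train_detect hγ (haux n) (haux_indep n)
    (hdetect_meas n (a n) (z n)) (by simpa only [hAtr', hZhat'] using hreal n)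
  have hev : ∀ n, {ω | Atr n ω = a n ∧ Zhat n ω = z n} = {ω | NetworkFission.train (A n ω) (W n ω)
      = a n ∧ detect n (NetworkFission.train (A n ω) (W n ω)) (aux n ω) = z n} := fun n => by
    simp only [hAtr', hZhat']
  simp only [← hev] at hcond
  have hZ : ∀ n, NetworkFission.IsMembership (z n) := fun n => by
    obtain ⟨ω, -, hω⟩ := nonempty_of_measure_ne_zero (hreal n)
    rw [← hω, hZhat]
    exact hdetect n _ _
  have hQ : ∀ n, IsProbabilityMeasure (cond (P n) {ω | Atr n ω = a n ∧ Zhat n ω = z n}) :=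
    fun n => cond_isProbabilityMeasure (hreal n)
  have hblock : ∀ᶠ n in atTop, ∀ k l, (NetworkFission.block (z n) k l).Nonempty :=
    eventually_all.2 fun k => eventually_all.2 fun l =>
      (hne 0 k l).mono fun n hn => NetworkFission.block_nonempty_of_subBlock hn
  have hcell : ∀ᶠ n in atTop, ∀ j, (NetworkFission.cell (z n) (a n) j).Nonempty :=
    eventually_all.2 fun j => hne j.2 j.1.2 j.1.1
  obtain ⟨N, hN⟩ := hconst
  have hbal : ∀ᶠ n : ℕ in atTop, NetworkFission.IsBalanced (n : ℝ) κ t₀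
      (NetworkFission.cell (z n) (a n)) (NetworkFission.cellWeight (z n) (a n) (u n (a n) (z n)))
      (NetworkFission.cellMean γ (z n) (M n))
      (fun p => ∫ ω, A n ω p.1 p.2 ∂(cond (P n) {ω | Atr n ω = a n ∧ Zhat n ω = z n})) := by
    filter_upwards [hblock, hcell, eventually_all.2 hb, eventually_ge_atTop N,
      eventually_gt_atTop 0] with n h1 h2 h3 h4 h5
    refine NetworkFission.isBalanced_cell hN₀ hN₁ (hM n) hl0 hh hlh (hZ n) h1 (hcond n).2.1
      (min_le_right _ _) (fun j => ?_) (hu n _ _) (hN n h4) (hcond n).2.2.1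
    have hn : (0 : ℝ) < (n : ℝ) ^ 2 := by
      have : (0 : ℝ) < n := by exact_mod_cast h5
      positivity
    have hc : (0 : ℝ) < (NetworkFission.cell (z n) (a n) j).card := by
      exact_mod_cast (h2 j).card_pos
    have h6 := h3 j
    rw [← div_eq_mul_inv, inv_le_comm₀ hc (div_pos (hC j) hn), inv_div] at h6
    calc κ * (n : ℝ) ^ 2 ≤ (C j)⁻¹ * (n : ℝ) ^ 2 := by
          gcongr
          exact (min_le_left _ _).trans (hκC j).1
      _ = (n : ℝ) ^ 2 / C j := by rw [div_eq_mul_inv, mul_comm]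
      _ ≤ _ := h6
  have hp : 1 - α / 2 ∈ Set.Ioo (0 : ℝ) 1 := ⟨by linarith [hα.2], by linarith [hα.1]⟩
  have main := NetworkFission.tendsto_measureReal_coverage (fun n => (hcond n).1) hκ0 ht₀0
    (e := NetworkFission.cellOdds K γ) (fun j => Real.exp_pos _) hbal
    (NetworkFission.normalQuantile_nonneg hp (by linarith [hα.2]))
  rw [NetworkFission.gaussianReal_Icc_normalQuantile hα] at main
  refine main.congr' ?_
  filter_upwards [hblock] with n h1
  -- Almost surely under the conditional law the train network and the communities equal `a n` and
  -- `z n`, so the coverage event becomes the event treated for fixed cells.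
  refine measureReal_congr ?_
  filter_upwards [(hcond n).2.2.2] with ω hω
  have hE : NetworkFission.expectation (P n) (A n) = M n := by
    ext i j
    exact ((hmodel n).edge_law i j).integral_eq
  have hM01 : ∀ k l, (NetworkFission.blockMean (NetworkFission.block (z n) k l)
      fun p => M n p.1 p.2) ∈ Set.Ioo (0 : ℝ) 1 := fun k l => by
    have := NetworkFission.blockMean_mem_Icc (h1 k l) (x := fun p => M n p.1 p.2)
      fun p _ => hM n p.1 p.2
    exact ⟨hN₀.trans_le this.1, this.2.trans_lt hN₁⟩
  have hAω : Atr n ω = a n := (hAtr n ω).trans hω.1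
  have hZω : Zhat n ω = z n := by rw [hZhat, hAtr]; exact hω.2
  refine propext ?_
  change _ ≤ _ ↔ NetworkFission.target _ _ _ ∈ _
  rw [hAω, hZω, hE, NetworkFission.mem_interval_iff,
    NetworkFission.xiHat_sub_target _ _ (hZ n) h1 (hcond n).2.1 hM01, NetworkFission.sigmaHat_eq]
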